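/- Let $T$ be a finite or countable set. A simple multitype branching process with type set $T$, root distribution $\dot\mu$ (a probability distribution on $T$) and offspring distributions $\mu^{k\to j}$ ($k,j\in T$, probability distributions on $\mathbb N=\{0,1,2,\dots\}$) is the random rooted tree $(U,\rho)$ in which the root $\rho$ has a random type with law $\dot\mu$, and each node of type $k$ has, for every $j\in T$, exactly $\xi^{j}\sim\mu^{k\to j}$ children of type $j$, the numbers $\xi^j$ being independent for distinct $j$ and for distinct nodes, and independent of the type of the root (the types being assigned to the enumerated children uniformly at random). It is assumed that the total number of children of a node, $\sum_j\xi^j$, is almost surely finite, for every type $k$ of the node. Give the nodes of $U$ independent labels $\sigma_v$, uniform on $[0,1]$ and independent of $U$. The past $\mathcal P_\rho$ of the root is the set of nodes reachable from $\rho$ by a path with decreasing labels. Assume that $(U,\rho)$ has nonexplosive growth, that is, $\mathcal P_\rho$ is almost surely finite, and let $\iota(U,\rho)=\Pr[\rho\in\mathbf I(U[\mathcal P_\rho])]$, where $\mathbf I(G)$ is the greedy maximal independent set of the finite labelled graph $G$: a vertex belongs to $\mathbf I(G)$ if and only if none of its neighbours with a smaller label does. For $x\in[0,1]$ let $\mu^{k\to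 j}_x=\mathsf{Bin}(\mu^{k\to j},x)$, that is, $\mu^{k\to j}_x(\ell)=\sum_{n\ge \ell}\mu^{k\to j}(n)\binom n\ell x^\ell(1-x)^{n-\ell}$. The fundamental system of ODEs of $(U,\rho)$ is $$y_k'(x)=\sum_{\ell\in\mathbb N^T}\ \prod_{j\in T}\mu^{k\to j}_x(\ell_j)\left(1-\frac{y_j(x)}{x}\right)^{\ell_j},\qquad y_k(0)=0\qquad(k\in T,\ x\in[0,1]),$$ with one-sided derivatives at $x=0$ and $x=1$; at $x=0$ the right-hand side is read as $1$, since only $\ell=0$ contributes. Then there is a solution $(y_k)_{k\in T}$ of the fundamental system with $0\le y_k(x)\le x$ for all $k\in T$ and $x\in[0,1]$, such that $$\iota(U,\rho)=\sum_{k\in T}y_k(1)\,\dot\mu(k),$$ and this formula holds for every solution of the fundamental system that satisfies $0\le y_k(x)\le x$ for all $k\in T$ and $x\in[0,1]$. -/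

import Mathlib

open MeasureTheory Set

noncomputable section

/-! ### Labelled graphs: the past of a vertex and the greedy maximal independent set -/

namespace SimpleGraph

/-- The past of `v`: the vertices that can be reached from `v` along a path of `G` on which the
labels `σ` decrease. -/
def past {V : Type*} (G : SimpleGraph V) (σ : V → unitInterval) (v : V) : Set V :=
  {u | Relation.ReflTransGen (fun a b => G.Adj a b ∧ σ b < σ a) v u}

theorem self_mem_past {V : Type*} (G : SimpleGraph V) (σ : V → unitInterval) (v : V) :
    v ∈ G.past σ v :=
  Relation.ReflTransGen.refl

theorem wellFounded_label {V : Type*} [Finite V] (σ : V → unitInterval) :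
    WellFounded (fun u v : V => σ u < σ v) := by
  have : IsTrans V (fun u v : V => σ u < σ v) := ⟨fun _ _ _ h h' => h.trans h'⟩
  have : Std.Irrefl (fun u v : V => σ u < σ v) := ⟨fun _ => lt_irrefl _⟩
  exact Finite.wellFounded_of_trans_of_irrefl _

/-- The greedy maximal independent set of a finite graph with arrival times `σ`: at the time given
by its label, a vertex becomes occupied if and only if all its neighbours are still vacant, that is,
if and only if no neighbour with a smaller label is occupied. -/
def greedyMIS {V : Type*} [Finite V] (G : SimpleGraph V) (σ : V → unitInterval) : Set V :=
  {v | (wellFounded_label σ).fix (C := fun _ => Prop)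
    (fun v occupied => ∀ (u : V) (h : σ u < σ v), G.Adj v u → ¬ occupied u h) v}

theorem mem_greedyMIS {V : Type*} [Finite V] (G : SimpleGraph V) (σ : V → unitInterval) (v : V) :
    v ∈ G.greedyMIS σ ↔ ∀ u, σ u < σ v → G.Adj v u → u ∉ G.greedyMIS σ := by
  unfold greedyMIS
  rw [mem_ofPred_eq, WellFounded.fix_eq]
  rfl

/-- The past of `v` is finite, and `v` belongs to the greedy maximal independent set of the subgraph
of `G` induced by it. -/
def GreedyOccupied {V : Type*} (G : SimpleGraph V) (σ : V → unitInterval) (v : V) : Prop :=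
  ∃ h : (G.past σ v).Finite,
    haveI : Finite (G.past σ v) := h.to_subtype
    (⟨v, G.self_mem_past σ v⟩ : G.past σ v) ∈
      (G.induce (G.past σ v)).greedyMIS (fun u => σ u)

end SimpleGraph

/-! ### Simple multitype branching processes -/

/-- The data of a simple multitype branching process with type set `T`. The numbers `ξ j` of children
of type `j` of a node of type `k` are independent for distinct `j`, with `ξ j ∼ offspring k j`; the
total number of children of a node is almost surely finite. -/
structure SimpleBranchingProcess (T : Type*) where
  /-- The distribution of the type of the root. -/
  root : PMF T
  /-- The distribution of the number of children of type `j` of a node of type `k`. -/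
  offspring : T → T → PMF ℕ
  finite_offspring : ∀ k, ∀ᵐ ξ ∂(Measure.infinitePi fun j => (offspring k j).toMeasure),
    (Function.support ξ).Finite

instance List.discreteMeasurableSpace {T : Type*} : MeasurableSpace (List T) := ⊤

namespace SimpleBranchingProcess

variable {T : Type*}

/-- The law of the offspring vector of a node of type `k`, a product measure. -/
def offspringLaw (B : SimpleBranchingProcess T) (k : T) : Measure (T → ℕ) :=
  Measure.infinitePi fun j => (B.offspring k j).toMeasure

open Classical in
theorem tsum_offspringLaw [Countable T] (B : SimpleBranchingProcess T) (k : T) :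
    ∑' s : Multiset T, B.offspringLaw k {fun j => s.count j} = 1 := by
  have : IsProbabilityMeasure (B.offspringLaw k) := by
    unfold offspringLaw; infer_instance
  have : Countable (Multiset T) := by
    unfold Multiset; infer_instance
  rw [← measure_iUnion]
  · rw [← prob_compl_eq_zero_iff₀]
    · refine measure_mono_null ?_ (B.finite_offspring k)
      intro ξ hξ hfin
      apply hξ
      rw [mem_iUnion]
      refine ⟨Finsupp.toMultiset (Finsupp.ofSupportFinite ξ hfin), ?_⟩
      rw [mem_singleton_iff]
      funext j
      rw [Finsupp.count_toMultiset]
      rfl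
    · exact (MeasurableSet.iUnion fun s => measurableSet_singleton _).nullMeasurableSet
  · intro s t hst
    rw [Function.onFun, disjoint_singleton]
    intro h
    exact hst (Multiset.ext.2 fun j => congrFun h j)
  · exact fun s => measurableSet_singleton _

open Classical in
/-- The law of the multiset of the types of the children of a node of type `k`. -/
def childMultisetLaw [Countable T] (B : SimpleBranchingProcess T) (k : T) : PMF (Multiset T) :=
  ⟨fun s => B.offspringLaw k {fun j => s.count j}, by
    rw [← B.tsum_offspringLaw k]; exact ENNReal.summable.hasSum⟩

theorem lists_nonempty [DecidableEq T] (s : Multiset T) : s.lists.toFinset.Nonempty := by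
  induction s using Quotient.inductionOn with
  | h l => exact ⟨l, Multiset.mem_toFinset.2 ((Multiset.mem_lists_iff _ _).2 rfl)⟩

open Classical in
/-- The law of the list of the types of the children `0, 1, …` of a node of type `k`: given the
multiset of the types, the list is uniform among its distinct orderings. -/
def childrenLaw [Countable T] (B : SimpleBranchingProcess T) (k : T) : PMF (List T) :=
  (B.childMultisetLaw k).bind fun s => PMF.uniformOfFinset s.lists.toFinset (lists_nonempty s)

/-- The sample space. Nodes are finite sequences of natural numbers, with the last element first:
`i :: v` is the child number `i` of `v`. -/
structure Sample (T : Type*) where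
  /-- The type of the root. -/
  rootType : T
  /-- `children (v, k)` lists the types of the children of `v`, in case `v` has type `k`. -/
  children : List ℕ × T → List T
  /-- The labels (arrival times). -/
  label : List ℕ → unitInterval

namespace Sample

/-- The sample space as a product. -/
def ofProd (p : T × (List ℕ × T → List T) × (List ℕ → unitInterval)) : Sample T :=
  ⟨p.1, p.2.1, p.2.2⟩

instance [MeasurableSpace T] : MeasurableSpace (Sample T) :=
  MeasurableSpace.map ofProd inferInstance

/-- The type of the node `v`, if `v` belongs to the tree. -/
def nodeType (ω : Sample T) : List ℕ → Option T
  | [] => some ω.rootType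
  | i :: v => (ω.nodeType v).bind fun k => (ω.children (v, k))[i]?

/-- The vertices of the tree. -/
def vertices (ω : Sample T) : Set (List ℕ) :=
  {v | (ω.nodeType v).isSome}

/-- The tree `U`: every vertex other than the root is joined to its parent. -/
def tree (ω : Sample T) : SimpleGraph ω.vertices :=
  SimpleGraph.fromRel fun u v => ∃ i : ℕ, (v : List ℕ) = i :: (u : List ℕ)

/-- The root `ρ` of the tree. -/
def root (ω : Sample T) : ω.vertices :=
  ⟨[], rfl⟩

/-- The labelling of the vertices of the tree. -/
def treeLabel (ω : Sample T) : ω.vertices → unitInterval :=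
  fun v => ω.label v

end Sample

section

variable [Countable T] [MeasurableSpace T]

/-- The probability measure: the type of the root, the offspring of the nodes and the labels are all
independent, and the labels are uniform on `[0, 1]`. -/
def law (B : SimpleBranchingProcess T) : Measure (Sample T) :=
  (B.root.toMeasure.prod
    ((Measure.infinitePi fun vk : List ℕ × T => (B.childrenLaw vk.2).toMeasure).prod
      (Measure.infinitePi fun _ : List ℕ => (volume : Measure unitInterval)))).map Sample.ofProd

/-- Nonexplosive growth: the past of the root is almost surely finite. -/
def NonexplosiveGrowth (B : SimpleBranchingProcess T) : Prop :=
  ∀ᵐ ω ∂B.law, (ω.tree.past ω.treeLabel ω.root).Finite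

/-- `ι(U, ρ)`: the probability that the root belongs to the greedy maximal independent set of the
subgraph induced by its past. -/
def iota (B : SimpleBranchingProcess T) : ℝ :=
  B.law.real {ω | ω.tree.GreedyOccupied ω.treeLabel ω.root}

end

/-- The mass at `ℓ` of `Bin(μ, x)`, the law of a binomial variable with `N` trials and success
probability `x`, where `N ∼ μ`. -/
def binMass (μ : PMF ℕ) (x : ℝ) (ℓ : ℕ) : ℝ :=
  ∑' n : ℕ, (μ n).toReal * (n.choose ℓ * x ^ ℓ * (1 - x) ^ (n - ℓ))

/-- The right hand side of the equation for `y k` in the fundamental system, at time `x` and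
with `y j x = z j`. -/
def fundamentalField (B : SimpleBranchingProcess T) (k : T) (x : ℝ) (z : T → ℝ) : ℝ :=
  ∑' ℓ : T → ℕ, ∏' j, binMass (B.offspring k j) x (ℓ j) * (1 - z j / x) ^ ℓ j

/-- The family `y` solves the fundamental system of ODEs on `[0, 1]` (with one-sided derivatives at
the endpoints). -/
def IsFundamentalSolution (B : SimpleBranchingProcess T) (y : T → ℝ → ℝ) : Prop :=
  ∀ k, y k 0 = 0 ∧ ∀ x ∈ Icc (0 : ℝ) 1,
    HasDerivWithinAt (y k) (B.fundamentalField k x fun j => y j x) (Icc 0 1) x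

end SimpleBranchingProcess

end

/-! The time dependence of the system is only apparent. If each of `Bin(n, x)` successes passes a
further test with probability `w = 1 - z/x`, all of them pass with probability `(1 - x + x w)^n = (1
- z)^n`. Hence for `0 ≤ z ≤ x` the right-hand side is the probability `vacancyField` that no child
is occupied when a child of type `j` is occupied with probability `z j`
(`fundamentalField_eq_vacancyField`).

A node with label `s` is occupied iff no child becomes occupied before time `s`, and the subtrees of
the children are independent. So the probability that a node of type `k` is occupied with label
below `x`, its descendants being explored to depth `n + 1`, is the integral over `[0, x]` of the
vacancy field at the depth-`n` probabilities. These probabilities are thus the Picard iterates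
`vacancyIter` started from `0` (`envLaw_arrival_lt`).

The vacancy field is antitone, so even iterates lie below and odd iterates above every admissible
solution (`vacancyIter_le_and_le`). When the past of the root is finite, the answer at depth `n` is
correct for all large `n`; hence the iterates at `1`, averaged over the type of the root, converge
to `iota` (`tendsto_rootOccupied`). Squeezing gives the formula for every admissible solution,
without proving that it is unique. Existence comes from a Peano argument
(`exists_solution_of_continuousOn`), which needs only continuity in the product topology and no
Lipschitz bound. -/

open Filter Topology ProbabilityTheory

/-! ### Existence of solutions of autonomous systems of ODEs with infinitely many unknowns -/

section Peano

variable {T : Type*}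

/-- The Euler polygon with step `1 / (n + 1)` of the autonomous system with right-hand side
`F` and initial value `0`, at the grid points. -/
noncomputable def eulerPolygon (F : T → (T → ℝ) → ℝ) (n : ℕ) : ℕ → T → ℝ
  | 0 => 0
  | i + 1 => fun k => eulerPolygon F n i k + F k (eulerPolygon F n i) / (n + 1)

variable {F : T → (T → ℝ) → ℝ}

theorem eulerPolygon_mem (hF : ∀ k z, (∀ j, z j ∈ Icc (0 : ℝ) 1) → F k z ∈ Icc (0 : ℝ) 1) (n : ℕ)
    (i : ℕ) (hi : i ≤ n + 1) (k : T) :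
    eulerPolygon F n i k ∈ Icc (0 : ℝ) (i / (n + 1)) := by
  have hn : (0 : ℝ) < n + 1 := by positivity
  induction i generalizing k with
  | zero => simp [eulerPolygon]
  | succ i ih =>
    have h1 : ∀ j, eulerPolygon F n i j ∈ Icc (0 : ℝ) 1 := fun j =>
      ⟨(ih (by omega) j).1, (ih (by omega) j).2.trans
        ((div_le_one hn).2 (by exact_mod_cast (by omega : i ≤ n + 1)))⟩
    have h2 := hF k _ h1
    have h3 := ih (by omega) k
    refine ⟨add_nonneg h3.1 (div_nonneg h2.1 hn.le), ?_⟩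
    have : F k (eulerPolygon F n i) / ((n : ℝ) + 1) ≤ 1 / (n + 1) := by
      gcongr; exact h2.2
    simp only [eulerPolygon]
    push_cast
    rw [add_div]
    exact add_le_add h3.2 this

theorem eulerPolygon_mem_unit (hF : ∀ k z, (∀ j, z j ∈ Icc (0 : ℝ) 1) → F k z ∈ Icc (0 : ℝ) 1)
    (n : ℕ) (i : ℕ) (hi : i ≤ n + 1) (k : T) : eulerPolygon F n i k ∈ Icc (0 : ℝ) 1 := by
  have hn : (0 : ℝ) < n + 1 := by positivity
  have h := eulerPolygon_mem hF n i hi k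
  exact ⟨h.1, h.2.trans ((div_le_one hn).2 (by exact_mod_cast hi))⟩

/-- Telescoping: if every slope used between two grid points is within `ε` of `c`, so is the mean
slope. This survives the limit and becomes differentiability. -/
theorem abs_eulerPolygon_sub_le {n i m : ℕ} (him : i ≤ m) (k : T) {c ε : ℝ}
    (h : ∀ t, i ≤ t → t < m → |F k (eulerPolygon F n t) - c| ≤ ε) :
    |eulerPolygon F n m k - eulerPolygon F n i k - ((m : ℝ) - i) / (n + 1) * c|
      ≤ ε * (((m : ℝ) - i) / (n + 1)) := by
  have hn : (0 : ℝ) < n + 1 := by positivity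
  induction m, him using Nat.le_induction with
  | base => simp
  | succ m him ih =>
    have h1 := ih fun t ht htm => h t ht (by omega)
    have h2 := h m him (by omega)
    have e : eulerPolygon F n (m + 1) k - eulerPolygon F n i k - (((m + 1 : ℕ) : ℝ) - i) / (n + 1) * c
      = (eulerPolygon F n m k - eulerPolygon F n i k - ((m : ℝ) - i) / (n + 1) * c)
        + (F k (eulerPolygon F n m) - c) / (n + 1) := by
      simp only [eulerPolygon]
      push_cast
      field_simp
      ring
    have e' : ε * ((((m + 1 : ℕ) : ℝ) - i) / (n + 1))
      = ε * (((m : ℝ) - i) / (n + 1)) + ε / (n + 1) := by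
      push_cast
      field_simp
      ring
    rw [e, e']
    refine (abs_add_le _ _).trans (add_le_add h1 ?_)
    rw [abs_div, abs_of_pos hn]
    gcongr

theorem abs_eulerPolygon_sub_le' (hF : ∀ k z, (∀ j, z j ∈ Icc (0 : ℝ) 1) → F k z ∈ Icc (0 : ℝ) 1)
    {n i m : ℕ} (him : i ≤ m) (hm : m ≤ n + 1) (k : T) :
    |eulerPolygon F n m k - eulerPolygon F n i k| ≤ ((m : ℝ) - i) / (n + 1) := by
  have := abs_eulerPolygon_sub_le (F := F) (n := n) him k (c := 0) (ε := 1) fun t _ ht => by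
    have := hF k _ (eulerPolygon_mem_unit hF n t (by omega))
    rw [sub_zero, abs_of_nonneg this.1]
    exact this.2
  simpa using this

theorem floor_sub_div_le {N a b : ℝ} (hN : 0 < N) (ha : 0 ≤ a) (hab : a ≤ b) :
    ((⌊N * b⌋₊ : ℝ) - ⌊N * a⌋₊) / N ≤ b - a + 1 / N := by
  have h1 := Nat.floor_le (a := N * b) (by nlinarith)
  have h2 := Nat.lt_floor_add_one (N * a)
  rw [div_le_iff₀ hN]
  field_simp
  linarith

theorem tendsto_floor_sub_div {a b : ℝ} (ha : 0 ≤ a) (hb : 0 ≤ b) :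
    Tendsto (fun n : ℕ => ((⌊((n : ℝ) + 1) * b⌋₊ : ℝ) - ⌊((n : ℝ) + 1) * a⌋₊) / (n + 1)) atTop
      (𝓝 (b - a)) := by
  have key : ∀ c : ℝ, 0 ≤ c →
      Tendsto (fun n : ℕ => (⌊((n : ℝ) + 1) * c⌋₊ : ℝ) / (n + 1)) atTop (𝓝 c) := by
    intro c hc
    have h := (tendsto_nat_floor_mul_div_atTop hc).comp
      (tendsto_atTop_add_const_right atTop (1 : ℝ) tendsto_natCast_atTop_atTop)
    refine h.congr fun n => ?_
    simp [mul_comm]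
  refine ((key b hb).sub (key a ha)).congr fun n => ?_
  rw [sub_div]

/-- A Peano type existence theorem for autonomous systems with arbitrarily many unknowns, whose
right-hand sides map the unit cube into the unit interval and are continuous for the product
topology. -/
theorem exists_solution_of_continuousOn
    (hF : ∀ k z, (∀ j, z j ∈ Icc (0 : ℝ) 1) → F k z ∈ Icc (0 : ℝ) 1)
    (hc : ∀ k, ContinuousOn (F k) {z | ∀ j, z j ∈ Icc (0 : ℝ) 1}) :
    ∃ y : T → ℝ → ℝ, ∀ k, y k 0 = 0 ∧ ∀ x ∈ Icc (0 : ℝ) 1, (0 ≤ y k x ∧ y k x ≤ x) ∧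
      HasDerivWithinAt (y k) (F k fun j => y j x) (Icc 0 1) x := by
  -- A nonprincipal ultrafilter makes all coordinates at all times converge at once. This replaces
  -- extraction of subsequences and works for an arbitrary index set `T`.
  let 𝒰 : Ultrafilter ℕ := hyperfilter ℕ
  have h𝒰 : (𝒰 : Filter ℕ) ≤ atTop := Nat.hyperfilter_le_atTop
  let a : ℕ → ℝ → T → ℝ := fun n x => eulerPolygon F n ⌊((n : ℝ) + 1) * x⌋₊
  have hfl : ∀ (n : ℕ) (x : ℝ), x ≤ 1 → ⌊((n : ℝ) + 1) * x⌋₊ ≤ n + 1 := by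
    intro n x hx
    refine Nat.floor_le_of_le ?_
    push_cast
    nlinarith [(Nat.cast_nonneg n : (0 : ℝ) ≤ n)]
  have ha : ∀ n x, x ∈ Icc (0 : ℝ) 1 → ∀ k, a n x k ∈ Icc 0 x := by
    intro n x hx k
    have hn : (0 : ℝ) < n + 1 := by positivity
    have h := eulerPolygon_mem hF n _ (hfl n x hx.2) k
    refine ⟨h.1, h.2.trans ?_⟩
    rw [div_le_iff₀ hn, mul_comm x]
    exact Nat.floor_le (mul_nonneg hn.le hx.1)
  have hlim : ∀ k x, ∃ l, x ∈ Icc (0 : ℝ) 1 →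
      l ∈ Icc 0 x ∧ Tendsto (fun n => a n x k) 𝒰 (𝓝 l) := by
    intro k x
    by_cases hx : x ∈ Icc (0 : ℝ) 1
    · obtain ⟨l, hl, hl'⟩ := (isCompact_Icc (a := (0 : ℝ)) (b := x)).ultrafilter_le_nhds
        (𝒰.map fun n => a n x k) (by
          rw [le_principal_iff]
          have h : ∀ᶠ n in (𝒰 : Filter ℕ), a n x k ∈ Icc 0 x :=
            Filter.Eventually.of_forall fun n => ha n x hx k
          exact h)
      exact ⟨l, fun _ => ⟨hl, hl'⟩⟩
    · exact ⟨0, fun h => absurd h hx⟩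
  choose y hy using hlim
  refine ⟨y, fun k => ⟨?_, fun x₀ hx₀ => ⟨(hy k x₀ hx₀).1, ?_⟩⟩⟩
  · have := (hy k 0 (by simp)).1
    exact le_antisymm this.2 this.1
  have hK : ∀ x ∈ Icc (0 : ℝ) 1, ∀ j, y j x ∈ Icc (0 : ℝ) 1 := fun x hx j =>
    ⟨(hy j x hx).1.1, (hy j x hx).1.2.trans hx.2⟩
  rw [hasDerivWithinAt_iff_isLittleO, Asymptotics.isLittleO_iff]
  intro ε hε
  set c := F k fun j => y j x₀ with hcdef
  have h1 := (hc k) (fun j => y j x₀) (hK x₀ hx₀)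
  have h2 : ∀ᶠ z in 𝓝[{z | ∀ j, z j ∈ Icc (0 : ℝ) 1}] (fun j => y j x₀), |F k z - c| < ε := by
    have := (Metric.tendsto_nhds.1 h1) ε hε
    simpa [Real.dist_eq] using this
  -- A neighbourhood in the product topology constrains only a finite set `J` of coordinates, so one
  -- `δ` serves them all.
  rw [eventually_nhdsWithin_iff, nhds_pi, Filter.Eventually, Filter.mem_pi] at h2
  obtain ⟨J, hJ, t, ht, hsub⟩ := h2
  have h3 : ∀ j, ∃ δ > 0, Metric.ball (y j x₀) δ ⊆ t j := fun j => Metric.mem_nhds_iff.1 (ht j)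
  choose δ' hδ' hball using h3
  obtain ⟨δ, hδ, hδJ⟩ : ∃ δ > 0, ∀ j ∈ J, δ ≤ δ' j := by
    have : ∀ᶠ δ in 𝓝[>] (0 : ℝ), ∀ j ∈ J, δ ≤ δ' j := by
      rw [Filter.eventually_all_finite hJ]
      intro j _
      exact nhdsWithin_le_nhds (eventually_le_nhds (hδ' j))
    obtain ⟨δ, h, h'⟩ := (this.and self_mem_nhdsWithin).exists
    exact ⟨δ, h', h⟩
  -- The three thirds of `δ` pay for the length `hi - lo`, the mesh `1 / (n + 1)`, and the distance
  -- of the polygon from its limit at `x₀`. The interval contains `x₀`, so taking `x₀` as either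
  -- endpoint gives the derivative from both sides.
  have hmain : ∀ lo hi : ℝ, 0 ≤ lo → lo ≤ x₀ → x₀ ≤ hi → hi ≤ 1 → hi - lo < δ / 3 →
      |y k hi - y k lo - (hi - lo) * c| ≤ ε * (hi - lo) := by
    intro lo hi hlo hlx hxh hhi hlt
    have hfl' := tendsto_floor_sub_div hlo (hlo.trans (hlx.trans hxh))
    refine le_of_tendsto_of_tendsto (b := (𝒰 : Filter ℕ))
      (f := fun n : ℕ => |a n hi k - a n lo k
        - ((⌊((n : ℝ) + 1) * hi⌋₊ : ℝ) - ⌊((n : ℝ) + 1) * lo⌋₊) / (n + 1) * c|)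
      (g := fun n : ℕ => ε * (((⌊((n : ℝ) + 1) * hi⌋₊ : ℝ) - ⌊((n : ℝ) + 1) * lo⌋₊) / (n + 1)))
      ?_ ((hfl'.mono_left h𝒰).const_mul ε) ?_
    · exact ((((hy k hi ⟨by linarith, hhi⟩).2).sub ((hy k lo ⟨hlo, by linarith⟩).2)).sub
        ((hfl'.mono_left h𝒰).mul_const c)).abs
    · have hN : ∀ᶠ n : ℕ in 𝒰, 1 / ((n : ℝ) + 1) < δ / 3 := by
        refine h𝒰 ?_
        exact (tendsto_one_div_add_atTop_nhds_zero_nat.eventually (gt_mem_nhds (by positivity)))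
      have hJ' : ∀ᶠ n : ℕ in 𝒰, ∀ j ∈ J, |a n x₀ j - y j x₀| < δ / 3 := by
        rw [Filter.eventually_all_finite hJ]
        intro j _
        have := (Metric.tendsto_nhds.1 (hy j x₀ hx₀).2) (δ / 3) (by positivity)
        simpa [Real.dist_eq] using this
      filter_upwards [hN, hJ'] with n hn hJn
      have hn0 : (0 : ℝ) < n + 1 := by positivity
      have m1 : ⌊((n : ℝ) + 1) * lo⌋₊ ≤ ⌊((n : ℝ) + 1) * x₀⌋₊ := Nat.floor_mono (by gcongr)
      have m2 : ⌊((n : ℝ) + 1) * x₀⌋₊ ≤ ⌊((n : ℝ) + 1) * hi⌋₊ := Nat.floor_mono (by gcongr)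
      have m3 := hfl n hi hhi
      have m4 := floor_sub_div_le hn0 hlo (hlx.trans hxh)
      refine abs_eulerPolygon_sub_le (m1.trans m2) k fun t ht1 ht2 => ?_
      refine (hsub (a := eulerPolygon F n t) ?_ ?_).le
      · intro j hj
        refine hball j ?_
        rw [Metric.mem_ball, Real.dist_eq]
        refine lt_of_lt_of_le ?_ (hδJ j hj)
        have hd : |eulerPolygon F n t j - a n x₀ j| ≤
            ((⌊((n : ℝ) + 1) * hi⌋₊ : ℝ) - ⌊((n : ℝ) + 1) * lo⌋₊) / (n + 1) := by
          have c1 : (⌊((n : ℝ) + 1) * lo⌋₊ : ℝ) ≤ ⌊((n : ℝ) + 1) * x₀⌋₊ := by exact_mod_cast m1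
          have c2 : (⌊((n : ℝ) + 1) * x₀⌋₊ : ℝ) ≤ ⌊((n : ℝ) + 1) * hi⌋₊ := by exact_mod_cast m2
          have c3 : (⌊((n : ℝ) + 1) * lo⌋₊ : ℝ) ≤ t := by exact_mod_cast ht1
          have c4 : (t : ℝ) ≤ ⌊((n : ℝ) + 1) * hi⌋₊ := by exact_mod_cast ht2.le
          rcases le_total t ⌊((n : ℝ) + 1) * x₀⌋₊ with h | h
          · rw [abs_sub_comm]
            refine (abs_eulerPolygon_sub_le' hF h (by omega) j).trans ?_
            gcongr
          · refine (abs_eulerPolygon_sub_le' hF h (by omega) j).trans ?_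
            gcongr
        have := abs_sub_le (eulerPolygon F n t j) (a n x₀ j) (y j x₀)
        linarith [hJn j hj]
      · exact eulerPolygon_mem_unit hF n t (by omega)
  have hnear : ∀ᶠ x in 𝓝[Icc 0 1] x₀, |x - x₀| < δ / 3 := by
    refine nhdsWithin_le_nhds ?_
    exact Metric.ball_mem_nhds x₀ (ε := δ / 3) (by positivity)
  filter_upwards [hnear, self_mem_nhdsWithin] with x hx hx01
  rw [Real.norm_eq_abs, Real.norm_eq_abs, smul_eq_mul]
  rcases le_total x x₀ with h | h
  · have := hmain x x₀ hx01.1 h le_rfl hx₀.2 (by rwa [abs_sub_comm, abs_of_nonneg (by linarith)] at hx)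
    rw [abs_sub_comm x x₀, abs_of_nonneg (by linarith : 0 ≤ x₀ - x)]
    rw [← abs_neg]
    convert! this using 2
    ring
  · have := hmain x₀ x hx₀.1 le_rfl h hx01.2 (by rwa [abs_of_nonneg (by linarith)] at hx)
    rw [abs_of_nonneg (by linarith : 0 ≤ x - x₀)]
    exact this

end Peano

/-! ### The vacancy field -/

namespace SimpleBranchingProcess

variable {T : Type*}

theorem list_prod_one_sub_mem {z : T → ℝ} (hz : ∀ j, z j ∈ Icc (0 : ℝ) 1) (l : List T) :
    (l.map fun j => 1 - z j).prod ∈ Icc (0 : ℝ) 1 := by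
  induction l with
  | nil => simp
  | cons j l ih =>
    have := hz j
    rw [List.map_cons, List.prod_cons]
    exact ⟨mul_nonneg (by linarith [this.2]) ih.1,
      mul_le_one₀ (by linarith [this.1]) ih.1 ih.2⟩

theorem list_prod_one_sub_antitone {z z' : T → ℝ} (hz : ∀ j, z j ∈ Icc (0 : ℝ) 1)
    (hz' : ∀ j, z' j ∈ Icc (0 : ℝ) 1) (h : ∀ j, z j ≤ z' j) (l : List T) :
    (l.map fun j => 1 - z' j).prod ≤ (l.map fun j => 1 - z j).prod := by
  induction l with
  | nil => simp
  | cons j l ih =>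
    rw [List.map_cons, List.prod_cons, List.map_cons, List.prod_cons]
    exact mul_le_mul (by linarith [h j]) ih (list_prod_one_sub_mem hz' l).1
      (by linarith [(hz j).2])

variable [Countable T]

/-- The probability that all children of a node of type `k` are vacant, if a child of type `j` is
occupied with probability `z j`, independently of the other children. -/
noncomputable def vacancyField (B : SimpleBranchingProcess T) (k : T) (z : T → ℝ) : ℝ :=
  ∑' l : List T, (B.childrenLaw k l).toReal * (l.map fun j => 1 - z j).prod

variable (B : SimpleBranchingProcess T) (k : T)

theorem hasSum_childrenLaw_toReal : HasSum (fun l => (B.childrenLaw k l).toReal) 1 := by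
  have h := ENNReal.hasSum_toReal (f := fun l => B.childrenLaw k l)
    (by rw [PMF.tsum_coe]; exact ENNReal.one_ne_top)
  rwa [← ENNReal.tsum_toReal_eq fun l => PMF.apply_ne_top _ _, PMF.tsum_coe,
    ENNReal.toReal_one] at h

variable {B k}

theorem summable_vacancyField {z : T → ℝ} (hz : ∀ j, z j ∈ Icc (0 : ℝ) 1) :
    Summable fun l : List T => (B.childrenLaw k l).toReal * (l.map fun j => 1 - z j).prod :=
  Summable.of_nonneg_of_le
    (fun l => mul_nonneg ENNReal.toReal_nonneg (list_prod_one_sub_mem hz l).1)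
    (fun l => mul_le_of_le_one_right ENNReal.toReal_nonneg (list_prod_one_sub_mem hz l).2)
    (B.hasSum_childrenLaw_toReal k).summable

theorem vacancyField_mem {z : T → ℝ} (hz : ∀ j, z j ∈ Icc (0 : ℝ) 1) :
    B.vacancyField k z ∈ Icc (0 : ℝ) 1 := by
  refine ⟨tsum_nonneg fun l => mul_nonneg ENNReal.toReal_nonneg (list_prod_one_sub_mem hz l).1, ?_⟩
  rw [← (B.hasSum_childrenLaw_toReal k).tsum_eq]
  exact (summable_vacancyField hz).tsum_le_tsum
    (fun l => mul_le_of_le_one_right ENNReal.toReal_nonneg (list_prod_one_sub_mem hz l).2)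
    (B.hasSum_childrenLaw_toReal k).summable

theorem vacancyField_antitone {z z' : T → ℝ} (hz : ∀ j, z j ∈ Icc (0 : ℝ) 1)
    (hz' : ∀ j, z' j ∈ Icc (0 : ℝ) 1) (h : ∀ j, z j ≤ z' j) :
    B.vacancyField k z' ≤ B.vacancyField k z :=
  (summable_vacancyField hz').tsum_le_tsum
    (fun l => mul_le_mul_of_nonneg_left (list_prod_one_sub_antitone hz hz' h l)
      ENNReal.toReal_nonneg) (summable_vacancyField hz)

/-- Weierstrass test: each term depends on finitely many coordinates and is dominated by the mass of
its list. This is why the product topology suffices. -/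
theorem continuousOn_vacancyField :
    ContinuousOn (B.vacancyField k) {z | ∀ j, z j ∈ Icc (0 : ℝ) 1} := by
  refine continuousOn_tsum (u := fun l => (B.childrenLaw k l).toReal) (fun l => ?_)
    (B.hasSum_childrenLaw_toReal k).summable fun l z hz => ?_
  · refine (continuous_const.mul ?_).continuousOn
    induction l with
    | nil => simpa using continuous_const
    | cons j l ih =>
      simp only [List.map_cons, List.prod_cons]
      exact (continuous_const.sub (continuous_apply j)).mul ih
  · have := list_prod_one_sub_mem hz l
    rw [Real.norm_eq_abs, abs_of_nonneg (mul_nonneg ENNReal.toReal_nonneg this.1)]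
    exact mul_le_of_le_one_right ENNReal.toReal_nonneg this.2

theorem continuousOn_vacancyField_comp {y : T → ℝ → ℝ} {s : Set ℝ}
    (hy : ∀ j, ContinuousOn (y j) s) (hmem : ∀ j, ∀ x ∈ s, y j x ∈ Icc (0 : ℝ) 1) :
    ContinuousOn (fun x => B.vacancyField k fun j => y j x) s :=
  continuousOn_vacancyField.comp (continuousOn_pi.2 hy) fun x hx j => hmem j x hx

/-! ### Alternating bounds for the solutions -/

/-- The iterates of the integral operator of the fundamental system, starting from `0`. -/
noncomputable def vacancyIter (B : SimpleBranchingProcess T) : ℕ → T → ℝ → ℝ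
  | 0 => 0
  | n + 1 => fun k x => ∫ s in (0 : ℝ)..x, B.vacancyField k fun j => vacancyIter B n j s

theorem integral_mem_of_mem_unit {f : ℝ → ℝ} (hf : ContinuousOn f (Icc 0 1))
    (hmem : ∀ s ∈ Icc (0 : ℝ) 1, f s ∈ Icc (0 : ℝ) 1) {x : ℝ} (hx : x ∈ Icc (0 : ℝ) 1) :
    ∫ s in (0 : ℝ)..x, f s ∈ Icc 0 x := by
  have hsub : Icc (0 : ℝ) x ⊆ Icc 0 1 := Icc_subset_Icc le_rfl hx.2
  refine ⟨intervalIntegral.integral_nonneg hx.1 fun s hs => (hmem s (hsub hs)).1, ?_⟩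
  have := intervalIntegral.integral_mono_on hx.1
    ((hf.mono hsub).intervalIntegrable_of_Icc hx.1) (intervalIntegrable_const (μ := volume) (c := (1 : ℝ)))
    fun s hs => (hmem s (hsub hs)).2
  simpa using this

theorem vacancyIter_continuousOn_and_mem (n : ℕ) (k : T) :
    ContinuousOn (B.vacancyIter n k) (Icc 0 1) ∧
      ∀ x ∈ Icc (0 : ℝ) 1, B.vacancyIter n k x ∈ Icc 0 x := by
  induction n generalizing k with
  | zero => exact ⟨continuousOn_const, fun x hx => ⟨le_rfl, hx.1⟩⟩
  | succ n ih =>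
    have hu : ∀ j, ∀ x ∈ Icc (0 : ℝ) 1, B.vacancyIter n j x ∈ Icc (0 : ℝ) 1 := fun j x hx =>
      ⟨((ih j).2 x hx).1, ((ih j).2 x hx).2.trans hx.2⟩
    have hc : ContinuousOn (fun x => B.vacancyField k fun j => B.vacancyIter n j x) (Icc 0 1) :=
      continuousOn_vacancyField_comp (fun j => (ih j).1) hu
    refine ⟨?_, fun x hx => integral_mem_of_mem_unit hc
      (fun s hs => vacancyField_mem fun j => hu j s hs) hx⟩
    have := intervalIntegral.continuousOn_primitive_interval (μ := volume) (a := 0) (b := 1)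
      (f := fun x => B.vacancyField k fun j => B.vacancyIter n j x)
      (by rw [uIcc_of_le zero_le_one]; exact hc.integrableOn_Icc)
    rwa [uIcc_of_le zero_le_one] at this

theorem vacancyIter_mem_unit (n : ℕ) (k : T) {x : ℝ} (hx : x ∈ Icc (0 : ℝ) 1) :
    B.vacancyIter n k x ∈ Icc (0 : ℝ) 1 :=
  ⟨((vacancyIter_continuousOn_and_mem n k).2 x hx).1,
    ((vacancyIter_continuousOn_and_mem n k).2 x hx).2.trans hx.2⟩

theorem continuousOn_vacancyField_vacancyIter (n : ℕ) (k : T) :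
    ContinuousOn (fun x => B.vacancyField k fun j => B.vacancyIter n j x) (Icc 0 1) :=
  continuousOn_vacancyField_comp (fun j => (vacancyIter_continuousOn_and_mem n j).1)
    fun j _ hx => vacancyIter_mem_unit n j hx

section Comparison

variable {y : T → ℝ → ℝ}

theorem continuousOn_vacancyField_solution
    (hmem : ∀ k, ∀ x ∈ Icc (0 : ℝ) 1, 0 ≤ y k x ∧ y k x ≤ x)
    (hy : ∀ k, y k 0 = 0 ∧ ∀ x ∈ Icc (0 : ℝ) 1,
      HasDerivWithinAt (y k) (B.vacancyField k fun j => y j x) (Icc 0 1) x)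
    (k : T) :
    ContinuousOn (fun x => B.vacancyField k fun j => y j x) (Icc 0 1) :=
  continuousOn_vacancyField_comp (fun j x hx => ((hy j).2 x hx).continuousWithinAt)
    fun j x hx => ⟨(hmem j x hx).1, (hmem j x hx).2.trans hx.2⟩

theorem solution_eq_integral
    (hmem : ∀ k, ∀ x ∈ Icc (0 : ℝ) 1, 0 ≤ y k x ∧ y k x ≤ x)
    (hy : ∀ k, y k 0 = 0 ∧ ∀ x ∈ Icc (0 : ℝ) 1,
      HasDerivWithinAt (y k) (B.vacancyField k fun j => y j x) (Icc 0 1) x)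
    (k : T) {x : ℝ} (hx : x ∈ Icc (0 : ℝ) 1) :
    y k x = ∫ s in (0 : ℝ)..x, B.vacancyField k fun j => y j s := by
  have hsub : Icc (0 : ℝ) x ⊆ Icc 0 1 := Icc_subset_Icc le_rfl hx.2
  rw [intervalIntegral.integral_eq_sub_of_hasDerivAt_of_le hx.1 (f := y k), (hy k).1, sub_zero]
  · exact fun s hs => (((hy k).2 s (hsub hs)).continuousWithinAt).mono hsub
  · intro s hs
    exact ((hy k).2 s ⟨hs.1.le, hs.2.le.trans hx.2⟩).hasDerivAt
      (Icc_mem_nhds hs.1 (hs.2.trans_le hx.2))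
  · exact ((continuousOn_vacancyField_solution hmem hy k).mono hsub).intervalIntegrable_of_Icc hx.1

/-- Integrating an antitone field turns lower bounds for the solution into upper bounds and
conversely. The induction starts from `0 ≤ y` and takes two such steps at a time. -/
theorem vacancyIter_le_and_le
    (hmem : ∀ k, ∀ x ∈ Icc (0 : ℝ) 1, 0 ≤ y k x ∧ y k x ≤ x)
    (hy : ∀ k, y k 0 = 0 ∧ ∀ x ∈ Icc (0 : ℝ) 1,
      HasDerivWithinAt (y k) (B.vacancyField k fun j => y j x) (Icc 0 1) x)
    (n : ℕ) (k : T) {x : ℝ} (hx : x ∈ Icc (0 : ℝ) 1) :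
    B.vacancyIter (2 * n) k x ≤ y k x ∧ y k x ≤ B.vacancyIter (2 * n + 1) k x := by
  have hyu : ∀ j, ∀ x ∈ Icc (0 : ℝ) 1, y j x ∈ Icc (0 : ℝ) 1 := fun j x hx =>
    ⟨(hmem j x hx).1, (hmem j x hx).2.trans hx.2⟩
  have hsub : ∀ {x : ℝ}, x ∈ Icc (0 : ℝ) 1 → Icc (0 : ℝ) x ⊆ Icc 0 1 := fun hx =>
    Icc_subset_Icc le_rfl hx.2
  have upper : ∀ m, (∀ k, ∀ x ∈ Icc (0 : ℝ) 1, B.vacancyIter m k x ≤ y k x) →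
      ∀ k, ∀ x ∈ Icc (0 : ℝ) 1, y k x ≤ B.vacancyIter (m + 1) k x := by
    intro m hm k x hx
    rw [solution_eq_integral hmem hy k hx]
    refine intervalIntegral.integral_mono_on hx.1
      (((continuousOn_vacancyField_solution hmem hy k).mono (hsub hx)).intervalIntegrable_of_Icc
        hx.1)
      (((continuousOn_vacancyField_vacancyIter m k).mono (hsub hx)).intervalIntegrable_of_Icc hx.1)
      fun s hs => ?_
    exact vacancyField_antitone (fun j => vacancyIter_mem_unit m j (hsub hx hs))
      (fun j => hyu j s (hsub hx hs)) fun j => hm j s (hsub hx hs)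
  have lower : ∀ m, (∀ k, ∀ x ∈ Icc (0 : ℝ) 1, y k x ≤ B.vacancyIter m k x) →
      ∀ k, ∀ x ∈ Icc (0 : ℝ) 1, B.vacancyIter (m + 1) k x ≤ y k x := by
    intro m hm k x hx
    rw [solution_eq_integral hmem hy k hx]
    refine intervalIntegral.integral_mono_on hx.1
      (((continuousOn_vacancyField_vacancyIter m k).mono (hsub hx)).intervalIntegrable_of_Icc hx.1)
      (((continuousOn_vacancyField_solution hmem hy k).mono (hsub hx)).intervalIntegrable_of_Icc
        hx.1)
      fun s hs => ?_
    exact vacancyField_antitone (fun j => hyu j s (hsub hx hs))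
      (fun j => vacancyIter_mem_unit m j (hsub hx hs)) fun j => hm j s (hsub hx hs)
  have main : ∀ n, ∀ k, ∀ x ∈ Icc (0 : ℝ) 1, B.vacancyIter (2 * n) k x ≤ y k x := by
    intro n
    induction n with
    | zero => exact fun k x hx => (hmem k x hx).1
    | succ n ih => exact lower _ (upper _ ih)
  exact ⟨main n k x hx, upper _ (main n) k x hx⟩

end Comparison

end SimpleBranchingProcess

namespace SimpleBranchingProcess

variable {T : Type*}

/-! ### The greedy independent set of a tree, explored up to a bounded depth -/

/-- Occupation of the node `v`, supposed to be of type `k`, computed from the descendants of `v` up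
to depth `n`. -/
def OccupiedUpTo (c : List ℕ × T → List T) (σ : List ℕ → unitInterval) : ℕ → List ℕ → T → Prop
  | 0, _, _ => False
  | n + 1, v, k => ∀ (i : ℕ) (hi : i < (c (v, k)).length), σ (i :: v) < σ v →
      ¬ OccupiedUpTo c σ n (i :: v) (c (v, k))[i]

namespace Sample

variable {ω : Sample T}

theorem tree_adj_iff {u v : ω.vertices} :
    ω.tree.Adj u v ↔ (∃ i : ℕ, (v : List ℕ) = i :: (u : List ℕ)) ∨
      ∃ i : ℕ, (u : List ℕ) = i :: (v : List ℕ) := by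
  unfold tree
  rw [SimpleGraph.fromRel_adj]
  refine ⟨fun h => h.2, fun h => ⟨?_, h⟩⟩
  rintro rfl
  rcases h with ⟨i, hi⟩ | ⟨i, hi⟩ <;> exact absurd hi (by simp)

/-- A node of the past of the root, other than the root, has a smaller label than its parent. -/
theorem label_lt_of_mem_past {u : ω.vertices} (hu : u ∈ ω.tree.past ω.treeLabel ω.root) :
    ∀ (i : ℕ) (v : List ℕ), (u : List ℕ) = i :: v → ω.label u < ω.label v := by
  have hu' : Relation.ReflTransGen
    (fun a b => ω.tree.Adj a b ∧ ω.treeLabel b < ω.treeLabel a) ω.root u := hu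
  induction hu' with
  | refl => intro i v h; exact absurd h (by simp [root])
  | @tail b w hb hbw ih =>
    intro i v h
    rcases tree_adj_iff.1 hbw.1 with ⟨i', h'⟩ | ⟨i', h'⟩
    · rw [h'] at h
      have hv : (b : List ℕ) = v := (List.cons.inj h).2
      rw [← hv]
      exact hbw.2
    -- A step back to the parent would raise the label, so paths with decreasing labels only descend
    -- the tree.
    · exact absurd hbw.2 (ih hb i' w h').not_gt

theorem nodeType_cons {v : List ℕ} {k : T} (hk : ω.nodeType v = some k) {i : ℕ}
    (hi : i < (ω.children (v, k)).length) :
    ω.nodeType (i :: v) = some (ω.children (v, k))[i] := by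
  simp [nodeType, hk, hi]

theorem exists_lt_of_nodeType_cons {v : List ℕ} {k : T} (hk : ω.nodeType v = some k) {i : ℕ}
    (h : (ω.nodeType (i :: v)).isSome) : i < (ω.children (v, k)).length := by
  by_contra hi
  simp [nodeType, hk, List.getElem?_eq_none (not_lt.1 hi)] at h

/-- The parent of a vertex of the past has a larger label, so only children can block it, and every
child with a smaller label is again in the past. Depth `0` is never reached, because `hn` would put
`v` deeper than `N`; the default value `False` there is harmless. -/
theorem mem_greedyMIS_iff_occupiedUpTo
    [Finite (ω.tree.past ω.treeLabel ω.root)]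
    {N : ℕ} (hN : ∀ u ∈ ω.tree.past ω.treeLabel ω.root, (u : List ℕ).length ≤ N) (n : ℕ)
    (v : ω.tree.past ω.treeLabel ω.root) (k : T) (hk : ω.nodeType v = some k)
    (hn : N + 1 ≤ n + (v : List ℕ).length) :
    v ∈ (ω.tree.induce (ω.tree.past ω.treeLabel ω.root)).greedyMIS (fun u => ω.treeLabel u) ↔
      OccupiedUpTo ω.children ω.label n v k := by
  induction n generalizing v k with
  | zero =>
    have := hN _ v.2
    omega
  | succ n ih =>
    rw [SimpleGraph.mem_greedyMIS]
    have child : ∀ (i : ℕ) (hi : i < (ω.children ((v : List ℕ), k)).length),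
        ω.label (i :: (v : List ℕ)) < ω.label (v : List ℕ) →
        ∃ u : ω.tree.past ω.treeLabel ω.root, (u : List ℕ) = i :: (v : List ℕ) ∧
          ω.tree.Adj v u := by
      intro i hi hlt
      let u : ω.vertices := ⟨i :: (v : List ℕ), by
        show (ω.nodeType _).isSome
        rw [nodeType_cons hk hi]; rfl⟩
      have hadj : ω.tree.Adj v u := tree_adj_iff.2 (Or.inl ⟨i, rfl⟩)
      refine ⟨⟨u, Relation.ReflTransGen.tail v.2 ⟨hadj, hlt⟩⟩, rfl, hadj⟩
    constructor
    · intro h i hi hlt hocc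
      obtain ⟨u, hu, hadj⟩ := child i hi hlt
      refine h u (by simpa [treeLabel, hu] using hlt) hadj ?_
      rw [ih u _ (by rw [hu]; exact nodeType_cons hk hi)]
      · rw [hu]; exact hocc
      · rw [hu, List.length_cons]; omega
    · intro h u hlt hadj hmem
      have hadj' : ω.tree.Adj v u := hadj
      rcases tree_adj_iff.1 hadj' with ⟨i, hi⟩ | ⟨i, hi⟩
      · have hlen := exists_lt_of_nodeType_cons hk (i := i) (by rw [← hi]; exact u.1.2)
        have hnt := nodeType_cons hk hlen
        rw [ih u _ (by rw [hi]; exact hnt) (by rw [hi, List.length_cons]; omega)] at hmem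
        rw [hi] at hmem
        refine h i hlen ?_ hmem
        rw [← hi]
        exact hlt
      · exact absurd hlt (label_lt_of_mem_past v.2 i u hi).not_gt

theorem eventually_greedyOccupied_iff (hfin : (ω.tree.past ω.treeLabel ω.root).Finite) :
    ∀ᶠ n in atTop, OccupiedUpTo ω.children ω.label n [] ω.rootType ↔
      ω.tree.GreedyOccupied ω.treeLabel ω.root := by
  obtain ⟨N, hN⟩ : ∃ N, ∀ u ∈ ω.tree.past ω.treeLabel ω.root, (u : List ℕ).length ≤ N := by
    obtain ⟨N, hN⟩ := (hfin.image fun u : ω.vertices => (u : List ℕ).length).bddAbove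
    exact ⟨N, fun u hu => hN ⟨u, hu, rfl⟩⟩
  filter_upwards [eventually_ge_atTop (N + 1)] with n hn
  have : Finite (ω.tree.past ω.treeLabel ω.root) := hfin.to_subtype
  have := mem_greedyMIS_iff_occupiedUpTo hN n ⟨ω.root, ω.tree.self_mem_past _ _⟩ ω.rootType
    rfl (by omega)
  rw [SimpleGraph.GreedyOccupied]
  exact ⟨fun h => ⟨hfin, this.2 h⟩, fun ⟨_, h⟩ => this.1 h⟩

end Sample

end SimpleBranchingProcess

/-! ### Infinite products of probabilities -/

section InfiniteProduct

variable {T : Type*} [Countable T] {α : Type*} [MeasurableSpace α]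

/-- The factors are at most `1`, so the finite products decrease to their infimum, also when that
limit is `0`. -/
theorem hasProd_infinitePi_real (π : T → Measure α) [∀ j, IsProbabilityMeasure (π j)]
    {t : T → Set α} (ht : ∀ j, MeasurableSet (t j)) :
    HasProd (fun j => (π j).real (t j)) ((Measure.infinitePi π).real (univ.pi t)) := by
  have h1 : ∀ j, π j (t j) ≤ 1 := fun j => prob_le_one
  have h := ENNReal.hasProd_iInf_prod h1
  rw [← ENNReal.tprod_eq_iInf_prod h1, ← Measure.infinitePi_pi_univ π ht] at h
  have h2 := (ENNReal.tendsto_toReal (measure_ne_top (Measure.infinitePi π) (univ.pi t))).comp h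
  refine h2.congr fun s => ?_
  simp [Measure.real, ENNReal.toReal_prod]

variable (π : T → Measure α) [∀ j, IsProbabilityMeasure (π j)] {A : T → Set α} {g : α → ℕ}

open Classical in
-- Almost surely the values of `g` are the multiplicities of a finite multiset, and there are
-- countably many of these: they partition the event up to a null set.
theorem hasSum_multiset_infinitePi_real (hA : ∀ j, MeasurableSet (A j)) (hg : Measurable g)
    (hfin : ∀ᵐ a ∂Measure.infinitePi π, (Function.support fun j => g (a j)).Finite) :
    HasSum (fun s : Multiset T =>
      (Measure.infinitePi π).real (univ.pi fun j => A j ∩ g ⁻¹' {s.count j}))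
      ((Measure.infinitePi π).real (univ.pi A)) := by
  have : Countable (Multiset T) := by unfold Multiset; infer_instance
  have hm : ∀ s : Multiset T, MeasurableSet (univ.pi fun j => A j ∩ g ⁻¹' {s.count j}) := fun s =>
    MeasurableSet.univ_pi fun j => (hA j).inter (hg (measurableSet_singleton _))
  have hd : Pairwise (Function.onFun Disjoint
      fun s : Multiset T => univ.pi fun j => A j ∩ g ⁻¹' {s.count j}) := by
    intro s t hst
    rw [Function.onFun, Set.disjoint_left]
    intro a ha ha'
    refine hst (Multiset.ext.2 fun j => ?_)
    exact (ha j trivial).2.symm.trans (ha' j trivial).2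
  have hU : Measure.infinitePi π (univ.pi A) =
      ∑' s : Multiset T, Measure.infinitePi π (univ.pi fun j => A j ∩ g ⁻¹' {s.count j}) := by
    rw [← measure_iUnion hd hm]
    refine measure_congr ?_
    filter_upwards [hfin] with a ha
    refine propext ⟨fun h => mem_iUnion.2
      ⟨Finsupp.toMultiset (Finsupp.ofSupportFinite _ ha), fun j _ => ⟨h j trivial, ?_⟩⟩, fun h => ?_⟩
    · rw [mem_preimage, mem_singleton_iff, Finsupp.count_toMultiset]
      rfl
    · obtain ⟨s, hs⟩ := mem_iUnion.1 h
      exact fun j hj => (hs j hj).1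
  unfold Measure.real
  rw [hU, ENNReal.tsum_toReal_eq fun s => measure_ne_top _ _]
  exact ENNReal.hasSum_toReal (by rw [← hU]; exact measure_ne_top _ _)

theorem hasSum_tprod_infinitePi_real (hA : ∀ j, MeasurableSet (A j)) (hg : Measurable g)
    (hfin : ∀ᵐ a ∂Measure.infinitePi π, (Function.support fun j => g (a j)).Finite) :
    HasSum (fun ℓ : T → ℕ => ∏' j, (π j).real (A j ∩ g ⁻¹' {ℓ j}))
      ((Measure.infinitePi π).real (univ.pi A)) := by
  classical
  have hm : ∀ ℓ : T → ℕ, ∀ j, MeasurableSet (A j ∩ g ⁻¹' {ℓ j}) := fun ℓ j =>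
    (hA j).inter (hg (measurableSet_singleton _))
  simp_rw [fun ℓ => (hasProd_infinitePi_real π (hm ℓ)).tprod_eq]
  have hinj : Function.Injective fun (s : Multiset T) (j : T) => s.count j := fun s t h =>
    Multiset.ext.2 fun j => congrFun h j
  -- The index set `T → ℕ` may be uncountable, but an `ℓ` of infinite support contributes `0`.
  refine (hinj.hasSum_iff fun ℓ hℓ => ?_).1 (hasSum_multiset_infinitePi_real π hA hg hfin)
  rw [measureReal_eq_zero_iff]
  refine measure_mono_null ?_ (ae_iff.1 hfin)
  intro a ha hfa
  refine hℓ ⟨Finsupp.toMultiset (Finsupp.ofSupportFinite _ hfa), funext fun j => ?_⟩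
  simp only [Finsupp.count_toMultiset]
  exact (ha j trivial).2

end InfiniteProduct

/-! ### Thinned offspring numbers -/

section Thinning

open ENNReal

theorem sum_binomial_mul_pow (n : ℕ) (x w : ℝ) :
    ∑ ℓ ∈ Finset.range (n + 1), (n.choose ℓ * x ^ ℓ * (1 - x) ^ (n - ℓ)) * w ^ ℓ
      = (1 - x + x * w) ^ n := by
  rw [add_comm (1 - x), add_pow]
  refine Finset.sum_congr rfl fun ℓ _ => ?_
  rw [mul_pow]
  ring

variable {x w : ℝ}

theorem thinning_weight_nonneg (hx : x ∈ Icc (0 : ℝ) 1) (hw : w ∈ Icc (0 : ℝ) 1) (n : ℕ)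
    (p : ℕ × Bool) :
    0 ≤ (n.choose p.1 * x ^ p.1 * (1 - x) ^ (n - p.1)) * (if p.2 then w ^ p.1 else 1 - w ^ p.1) := by
  have h1 : 0 ≤ 1 - x := by linarith [hx.2]
  have h2 : w ^ p.1 ≤ 1 := pow_le_one₀ hw.1 hw.2
  have h3 := hx.1
  have h4 : 0 ≤ w ^ p.1 := pow_nonneg hw.1 _
  refine mul_nonneg (by positivity) ?_
  split_ifs <;> linarith

/-- The joint law of a binomial number of successes among `n` trials, and of the event that all of
them pass a further independent test with success probability `w`. -/
noncomputable def thinningKernel (hx : x ∈ Icc (0 : ℝ) 1) (hw : w ∈ Icc (0 : ℝ) 1) (n : ℕ) :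
    PMF (ℕ × Bool) :=
  PMF.ofFinset (fun p => ENNReal.ofReal ((n.choose p.1 * x ^ p.1 * (1 - x) ^ (n - p.1)) *
      (if p.2 then w ^ p.1 else 1 - w ^ p.1)))
    (Finset.range (n + 1) ×ˢ Finset.univ)
    (by
      rw [← ENNReal.ofReal_sum_of_nonneg fun p _ => thinning_weight_nonneg hx hw n p,
        Finset.sum_product]
      have h := sum_binomial_mul_pow n x 1
      simp only [one_pow, mul_one, sub_add_cancel] at h
      simp only [Fintype.sum_bool, if_true, Bool.false_eq_true, if_false, ← mul_add,
        add_sub_cancel, mul_one]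
      rw [h, ENNReal.ofReal_one])
    (by
      rintro ⟨ℓ, b⟩ h
      have : n < ℓ := by simpa using h
      simp [Nat.choose_eq_zero_of_lt this])

theorem thinningKernel_apply (hx : x ∈ Icc (0 : ℝ) 1) (hw : w ∈ Icc (0 : ℝ) 1) (n : ℕ)
    (p : ℕ × Bool) : (thinningKernel hx hw n p).toReal =
      (n.choose p.1 * x ^ p.1 * (1 - x) ^ (n - p.1)) * (if p.2 then w ^ p.1 else 1 - w ^ p.1) := by
  rw [thinningKernel, PMF.ofFinset_apply, ENNReal.toReal_ofReal (thinning_weight_nonneg hx hw n p)]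

/-- The joint law of a number of trials with law `μ`, of the number of successes, and of the event
that all of these pass a further independent test with success probability `w`. -/
noncomputable def thinning (μ : PMF ℕ) (hx : x ∈ Icc (0 : ℝ) 1) (hw : w ∈ Icc (0 : ℝ) 1) :
    PMF (ℕ × ℕ × Bool) :=
  μ.bind fun n => (thinningKernel hx hw n).map (Prod.mk n)

variable (μ : PMF ℕ) (hx : x ∈ Icc (0 : ℝ) 1) (hw : w ∈ Icc (0 : ℝ) 1)

theorem thinning_map_fst : (thinning μ hx hw).toMeasure.map Prod.fst = μ.toMeasure := by
  rw [PMF.toMeasure_map _ _ measurable_fst, thinning, PMF.map_bind]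
  congr 1
  have : ∀ n, (((thinningKernel hx hw n).map (Prod.mk n)).map Prod.fst) = PMF.pure n := by
    intro n
    rw [PMF.map_comp]
    exact PMF.map_const _ n
  simp_rw [this]
  exact PMF.bind_pure μ

theorem thinning_measure_apply (s : Set (ℕ × ℕ × Bool)) :
    (thinning μ hx hw).toMeasure s =
      ∑' n, μ n * (thinningKernel hx hw n).toMeasure (Prod.mk n ⁻¹' s) := by
  rw [thinning, PMF.toMeasure_bind_apply _ _ _ (MeasurableSet.of_discrete)]
  refine tsum_congr fun n => ?_
  rw [← PMF.toMeasure_map _ _ (measurable_of_countable _),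
    Measure.map_apply (measurable_of_countable _) MeasurableSet.of_discrete]

theorem thinning_real_apply (s : Set (ℕ × ℕ × Bool)) :
    (thinning μ hx hw).toMeasure.real s =
      ∑' n, (μ n).toReal * (thinningKernel hx hw n).toMeasure.real (Prod.mk n ⁻¹' s) := by
  rw [Measure.real, thinning_measure_apply, ENNReal.tsum_toReal_eq]
  · simp_rw [ENNReal.toReal_mul, Measure.real]
  · exact fun n => ENNReal.mul_ne_top (PMF.apply_ne_top _ _) (measure_ne_top _ _)

theorem thinning_ae_le : ∀ᵐ a ∂(thinning μ hx hw).toMeasure, a.2.1 ≤ a.1 := by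
  rw [ae_iff, thinning_measure_apply]
  refine ENNReal.tsum_eq_zero.2 fun n => ?_
  rw [PMF.toMeasure_apply_eq_zero_iff _ MeasurableSet.of_discrete |>.2, mul_zero]
  rw [Set.disjoint_left]
  rintro ⟨ℓ, b⟩ h h'
  have h' : n < ℓ := by simpa using h'
  rw [PMF.mem_support_iff] at h
  exact h (by simp [thinningKernel, PMF.ofFinset_apply, Nat.choose_eq_zero_of_lt h'])

/-- Splitting the event that all successes pass by their number yields the factors of
`fundamentalField`; splitting it by the number of trials, in `thinning_real_trials`, yields those of
`vacancyField`. -/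
theorem thinning_real_successes (ℓ : ℕ) :
    (thinning μ hx hw).toMeasure.real ({a | a.2.2 = true} ∩ (fun a => a.2.1) ⁻¹' {ℓ}) =
      SimpleBranchingProcess.binMass μ x ℓ * w ^ ℓ := by
  rw [thinning_real_apply, SimpleBranchingProcess.binMass, ← tsum_mul_right]
  refine tsum_congr fun n => ?_
  have : (Prod.mk n ⁻¹' ({a : ℕ × ℕ × Bool | a.2.2 = true} ∩ (fun a => a.2.1) ⁻¹' {ℓ}))
      = {(ℓ, true)} := by
    ext ⟨ℓ', b⟩
    simp [and_comm]
  rw [this, Measure.real, PMF.toMeasure_apply_singleton _ _ (measurableSet_singleton _),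
    thinningKernel_apply]
  simp only [if_true]
  ring

theorem thinning_real_trials (n : ℕ) :
    (thinning μ hx hw).toMeasure.real ({a | a.2.2 = true} ∩ Prod.fst ⁻¹' {n}) =
      (μ n).toReal * (1 - x + x * w) ^ n := by
  rw [thinning_real_apply, tsum_eq_single n]
  · congr 1
    have : (Prod.mk n ⁻¹' ({a : ℕ × ℕ × Bool | a.2.2 = true} ∩ Prod.fst ⁻¹' {n}))
        = {p : ℕ × Bool | p.2 = true} := by
      ext ⟨ℓ', b⟩
      simp
    rw [this, Measure.real, PMF.toMeasure_apply _ MeasurableSet.of_discrete,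
      tsum_eq_sum (s := Finset.range (n + 1) ×ˢ Finset.univ), ENNReal.toReal_sum,
      Finset.sum_product, ← sum_binomial_mul_pow]
    · refine Finset.sum_congr rfl fun ℓ _ => ?_
      rw [Fintype.sum_bool]
      simp [indicator, thinningKernel_apply]
    · intro p _
      refine ne_top_of_le_ne_top (PMF.apply_ne_top (thinningKernel hx hw n) p) ?_
      exact indicator_le_self _ _ _
    · intro p hp
      have h0 : thinningKernel hx hw n p = 0 := by
        rw [thinningKernel]
        exact PMF.ofFinset_apply_of_notMem _ _ hp
      simp [indicator, h0]
  · intro m hm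
    have : (Prod.mk m ⁻¹' ({a : ℕ × ℕ × Bool | a.2.2 = true} ∩ Prod.fst ⁻¹' {n})) = ∅ := by
      ext p
      simp [hm]
    rw [this]
    simp

end Thinning

/-! ### The fundamental system is autonomous -/

namespace SimpleBranchingProcess

variable {T : Type*} [Countable T] (B : SimpleBranchingProcess T) (k : T)

open Classical in
-- The random ordering of the children is invisible to symmetric functions of the list.
theorem tsum_childrenLaw_mul (f : Multiset T → ENNReal) :
    ∑' l : List T, B.childrenLaw k l * f l = ∑' s, B.childMultisetLaw k s * f s := by
  simp_rw [childrenLaw, PMF.bind_apply, ← ENNReal.tsum_mul_right]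
  rw [ENNReal.tsum_comm]
  refine tsum_congr fun s => ?_
  simp_rw [mul_assoc]
  rw [ENNReal.tsum_mul_left]
  congr 1
  have h : ∀ l : List T, (PMF.uniformOfFinset s.lists.toFinset (lists_nonempty s)) l * f l
      = (PMF.uniformOfFinset s.lists.toFinset (lists_nonempty s)) l * f s := by
    intro l
    by_cases hl : l ∈ s.lists.toFinset
    · rw [Multiset.mem_toFinset, Multiset.mem_lists_iff] at hl
      subst hl
      rfl
    · rw [PMF.uniformOfFinset_apply_of_notMem _ hl, zero_mul, zero_mul]
  simp_rw [h]
  rw [ENNReal.tsum_mul_right, PMF.tsum_coe, one_mul]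

theorem vacancyField_eq_tsum_multiset {z : T → ℝ} (hz : ∀ j, z j ∈ Icc (0 : ℝ) 1) :
    B.vacancyField k z =
      ∑' s : Multiset T, (B.childMultisetLaw k s).toReal * (s.map fun j => 1 - z j).prod := by
  have hp : ∀ s : Multiset T, 0 ≤ (s.map fun j => 1 - z j).prod := by
    intro s
    induction s using Quotient.inductionOn with
    | h l => simpa using (list_prod_one_sub_mem hz l).1
  have h := congrArg ENNReal.toReal (B.tsum_childrenLaw_mul k
    fun s => ENNReal.ofReal (s.map fun j => 1 - z j).prod)
  rw [ENNReal.tsum_toReal_eq fun l => ENNReal.mul_ne_top (PMF.apply_ne_top _ _) ENNReal.ofReal_ne_top,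
    ENNReal.tsum_toReal_eq fun l => ENNReal.mul_ne_top (PMF.apply_ne_top _ _) ENNReal.ofReal_ne_top]
    at h
  simp_rw [ENNReal.toReal_mul, ENNReal.toReal_ofReal (hp _)] at h
  rw [← h, vacancyField]
  simp

/-- In the unit cube, the right-hand side of the fundamental system does not depend on time. -/
theorem fundamentalField_eq_vacancyField {x : ℝ} (hx : x ∈ Icc (0 : ℝ) 1) {z : T → ℝ}
    (hz : ∀ j, 0 ≤ z j ∧ z j ≤ x) : B.fundamentalField k x z = B.vacancyField k z := by
  classical
  have hw : ∀ j, 1 - z j / x ∈ Icc (0 : ℝ) 1 := fun j =>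
    ⟨sub_nonneg.2 (div_le_one_of_le₀ (hz j).2 hx.1),
      sub_le_self _ (div_nonneg (hz j).1 hx.1)⟩
  -- At `x = 0` the bounds force `z j = 0`, and with `z j / 0 = 0` both sides are `1`.
  have hxw : ∀ j, 1 - x + x * (1 - z j / x) = 1 - z j := by
    intro j
    rcases hx.1.eq_or_lt with h | h
    · have := hz j
      rw [← h] at this ⊢
      rw [le_antisymm this.2 this.1]
      simp
    · field_simp
      ring
  -- Both fields are the probability of one event under this coupling, that all types pass their
  -- tests. This avoids interchanging infinite sums and products.
  let π : T → Measure (ℕ × ℕ × Bool) := fun j => (thinning (B.offspring k j) hx (hw j)).toMeasure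
  have hfst : ∀ᵐ a ∂Measure.infinitePi π, (Function.support fun j => (a j).1).Finite := by
    have h1 := Measure.infinitePi_map_pi π (f := fun _ => Prod.fst) fun _ => measurable_fst
    have h2 : (fun j => (π j).map Prod.fst) = fun j => (B.offspring k j).toMeasure :=
      funext fun j => thinning_map_fst _ _ _
    rw [h2] at h1
    have h3 := B.finite_offspring k
    rw [← h1] at h3
    exact ae_of_ae_map (f := fun (a : T → ℕ × ℕ × Bool) j => (a j).1)
      (measurable_pi_lambda _ fun j => measurable_fst.comp (measurable_pi_apply j)).aemeasurable h3
  have hsnd : ∀ᵐ a ∂Measure.infinitePi π, (Function.support fun j => (a j).2.1).Finite := by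
    have hle : ∀ᵐ a ∂Measure.infinitePi π, ∀ j, (a j).2.1 ≤ (a j).1 := by
      rw [ae_all_iff]
      intro j
      exact (measurePreserving_eval_infinitePi π j).quasiMeasurePreserving.ae
        (thinning_ae_le (B.offspring k j) hx (hw j))
    filter_upwards [hfst, hle] with a ha hl
    refine ha.subset fun j hj h0 => hj ?_
    have h0 : (a j).1 = 0 := h0
    have := hl j
    simp only
    omega
  have hA : ∀ j : T, MeasurableSet {a : ℕ × ℕ × Bool | a.2.2 = true} := fun _ =>
    MeasurableSet.of_discrete
  have e1 := hasSum_tprod_infinitePi_real π hA (g := fun a => a.2.1) (measurable_of_countable _) hsnd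
  have e2 := hasSum_multiset_infinitePi_real π hA (g := Prod.fst) measurable_fst hfst
  have e3 : B.fundamentalField k x z = (Measure.infinitePi π).real
      (univ.pi fun _ => {a : ℕ × ℕ × Bool | a.2.2 = true}) := by
    rw [← e1.tsum_eq, fundamentalField]
    refine tsum_congr fun ℓ => tprod_congr fun j => ?_
    exact (thinning_real_successes (B.offspring k j) hx (hw j) (ℓ j)).symm
  rw [e3, ← e2.tsum_eq, vacancyField_eq_tsum_multiset B k
    fun j => ⟨(hz j).1, (hz j).2.trans hx.2⟩]
  refine tsum_congr fun s => ?_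
  have hp1 := hasProd_infinitePi_real π (t := fun j => {a : ℕ × ℕ × Bool | a.2.2 = true} ∩
    Prod.fst ⁻¹' {s.count j}) fun j => MeasurableSet.of_discrete
  have hp2 : HasProd (fun j => (B.offspring k j).toMeasure.real {s.count j})
      (B.childMultisetLaw k s).toReal := by
    have := hasProd_infinitePi_real (fun j => (B.offspring k j).toMeasure)
      (t := fun j => {s.count j}) fun j => measurableSet_singleton _
    rw [Set.univ_pi_singleton] at this
    exact this
  have hp3 : HasProd (fun j => (1 - z j) ^ s.count j) (s.map fun j => 1 - z j).prod := by
    rw [Finset.prod_multiset_map_count]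
    exact hasProd_prod_of_ne_finset_one fun j hj => by
      rw [Multiset.mem_toFinset, ← Multiset.count_eq_zero] at hj
      rw [hj, pow_zero]
  refine hp1.unique ?_
  convert! hp2.mul hp3 using 2 with j
  have := thinning_real_trials (B.offspring k j) hx (hw j) (s.count j)
  rw [hxw] at this
  rw [Measure.real, Measure.real, PMF.toMeasure_apply_singleton _ _ (measurableSet_singleton _)]
  exact this

end SimpleBranchingProcess

namespace SimpleBranchingProcess

variable {T : Type*}

/-! ### The random environment -/

/-- The offspring lists and the labels of all potential nodes. -/
abbrev Env (T : Type*) : Type _ := (List ℕ × T → List T) × (List ℕ → unitInterval)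

/-- The σ-algebra generated by one offspring list or one label. -/
@[reducible]
def coordAlg (T : Type*) : (List ℕ × T) ⊕ List ℕ → MeasurableSpace (Env T)
  | Sum.inl vk => MeasurableSpace.comap (fun p => p.1 vk) inferInstance
  | Sum.inr v => MeasurableSpace.comap (fun p => p.2 v) inferInstance

/-- The σ-algebra generated by a set of offspring lists and labels. -/
@[reducible]
def blockAlg (S : Set ((List ℕ × T) ⊕ List ℕ)) : MeasurableSpace (Env T) :=
  ⨆ i ∈ S, coordAlg T i

theorem coordAlg_le (i : (List ℕ × T) ⊕ List ℕ) : coordAlg T i ≤ (inferInstance : MeasurableSpace (Env T)) := by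
  rcases i with vk | v
  · exact Measurable.comap_le ((measurable_pi_apply vk).comp measurable_fst)
  · exact Measurable.comap_le ((measurable_pi_apply v).comp measurable_snd)

theorem blockAlg_le (S : Set ((List ℕ × T) ⊕ List ℕ)) :
    blockAlg S ≤ (inferInstance : MeasurableSpace (Env T)) :=
  iSup₂_le fun i _ => coordAlg_le i

theorem blockAlg_mono {S S' : Set ((List ℕ × T) ⊕ List ℕ)} (h : S ⊆ S') :
    blockAlg S ≤ blockAlg S' :=
  biSup_mono h

theorem measurable_children {S : Set ((List ℕ × T) ⊕ List ℕ)} {vk : List ℕ × T}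
    (h : Sum.inl vk ∈ S) : Measurable[blockAlg S] fun p : Env T => p.1 vk :=
  measurable_iff_comap_le.2 (le_iSup₂ (f := fun i _ => coordAlg T i) (Sum.inl vk) h)

theorem measurable_label {S : Set ((List ℕ × T) ⊕ List ℕ)} {v : List ℕ}
    (h : Sum.inr v ∈ S) : Measurable[blockAlg S] fun p : Env T => p.2 v :=
  measurable_iff_comap_le.2 (le_iSup₂ (f := fun i _ => coordAlg T i) (Sum.inr v) h)

/-- The coordinates that belong to `v` and its descendants. -/
def descendants (T : Type*) (v : List ℕ) : Set ((List ℕ × T) ⊕ List ℕ) :=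
  {i | v <:+ Sum.elim Prod.fst id i}

/-- The coordinates that belong to the children `i ≥ m` of `v` and their descendants. -/
def laterDescendants (T : Type*) (v : List ℕ) (m : ℕ) : Set ((List ℕ × T) ⊕ List ℕ) :=
  {i | ∃ j, m ≤ j ∧ j :: v <:+ Sum.elim Prod.fst id i}

theorem laterDescendants_subset (v : List ℕ) (m : ℕ) :
    laterDescendants T v m ⊆ descendants T v := by
  rintro i ⟨j, -, hj⟩
  exact (List.suffix_cons j v).trans hj

theorem descendants_subset_laterDescendants (v : List ℕ) (m : ℕ) :
    descendants T (m :: v) ⊆ laterDescendants T v m :=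
  fun _ hi => ⟨m, le_rfl, hi⟩

theorem eq_of_cons_suffix {v w : List ℕ} {i j : ℕ} (hi : i :: v <:+ w) (hj : j :: v <:+ w) :
    i = j := by
  have := List.suffix_of_suffix_length_le hi hj (by simp)
  have := this.eq_of_length (by simp)
  exact (List.cons.inj this).1

theorem disjoint_descendants_laterDescendants (v : List ℕ) (m : ℕ) :
    Disjoint (descendants T (m :: v)) (laterDescendants T v (m + 1)) := by
  rw [Set.disjoint_left]
  rintro i hi ⟨j, hj, h⟩
  have := eq_of_cons_suffix hi h
  omega

theorem notMem_laterDescendants_of_elim_eq {v : List ℕ} {m : ℕ} {i : (List ℕ × T) ⊕ List ℕ}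
    (hi : Sum.elim Prod.fst id i = v) : i ∉ laterDescendants T v m := by
  rintro ⟨j, -, h⟩
  rw [hi] at h
  simpa using h.length_le

/-- The minimum of the values of the `m`-th, `(m + 1)`-st, … child, where `l` lists their types. -/
noncomputable def firstOf (child : ℕ → T → unitInterval) : ℕ → List T → unitInterval
  | _, [] => 1
  | m, j :: l => min (child m j) (firstOf child (m + 1) l)

theorem le_firstOf_iff (child : ℕ → T → unitInterval) (s : unitInterval) (m : ℕ) (l : List T) :
    s ≤ firstOf child m l ↔ ∀ (i : ℕ) (hi : i < l.length), s ≤ child (m + i) l[i] := by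
  induction l generalizing m with
  | nil => simpa [firstOf] using unitInterval.le_one' (t := s)
  | cons j l ih =>
    rw [firstOf, le_min_iff, ih]
    constructor
    · rintro ⟨h0, h⟩ i hi
      cases i with
      | zero => exact h0
      | succ i =>
        have := h i (by simpa using hi)
        rw [show m + (i + 1) = m + 1 + i by omega]
        exact this
    · intro h
      refine ⟨h 0 (by simp), fun i hi => ?_⟩
      have := h (i + 1) (by simpa using hi)
      rwa [show m + (i + 1) = m + 1 + i by omega] at this

open Classical in
/-- The time when the node `v`, of type `k`, becomes occupied if its descendants are explored up to
depth `n`; the value is `1` if it remains vacant. -/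
noncomputable def arrival (n : ℕ) (v : List ℕ) (k : T) (p : Env T) : unitInterval :=
  if OccupiedUpTo p.1 p.2 n v k then p.2 v else 1

/-- A vacant child gets arrival time `1`, which never precedes a label; the greedy rule thus becomes
a comparison of the label with one minimum. -/
theorem occupiedUpTo_succ_iff (n : ℕ) (v : List ℕ) (k : T) (p : Env T) :
    OccupiedUpTo p.1 p.2 (n + 1) v k ↔
      p.2 v ≤ firstOf (fun i j => arrival n (i :: v) j p) 0 (p.1 (v, k)) := by
  rw [le_firstOf_iff]
  refine forall₂_congr fun i hi => ?_
  rw [zero_add, arrival]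
  split_ifs with h
  · simp [h]
  · simp [h, unitInterval.le_one']

theorem arrival_lt_iff (n : ℕ) (v : List ℕ) (k : T) (p : Env T) (x : unitInterval) :
    arrival n v k p < x ↔ OccupiedUpTo p.1 p.2 n v k ∧ p.2 v < x := by
  rw [arrival]
  split_ifs with h
  · simp [h]
  · simp [h, unitInterval.le_one']

instance : DiscreteMeasurableSpace (List T) := ⟨fun _ => trivial⟩

section Measurability

theorem measurable_firstOf {m : MeasurableSpace (Env T)} {child : ℕ → T → Env T → unitInterval}
    (l : List T) (a : ℕ) (h : ∀ i, a ≤ i → ∀ j, Measurable (child i j)) :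
    Measurable fun p => firstOf (fun i j => child i j p) a l := by
  induction l generalizing a with
  | nil => exact measurable_const
  | cons j l ih => exact (h a le_rfl j).min (ih (a + 1) fun i hi => h i (by omega))

variable [Countable T]

theorem measurableSet_occupiedUpTo_succ {n : ℕ}
    (hn : ∀ v k, Measurable[blockAlg (descendants T v)] (arrival (T := T) n v k))
    (v : List ℕ) (k : T) :
    MeasurableSet[blockAlg (descendants T v)] {p : Env T | OccupiedUpTo p.1 p.2 (n + 1) v k} := by
  have hf : ∀ l, Measurable[blockAlg (descendants T v)]
      fun p : Env T => firstOf (fun i j => arrival n (i :: v) j p) 0 l := fun l =>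
    measurable_firstOf l 0 fun i _ j => (hn (i :: v) j).mono
      (blockAlg_mono ((descendants_subset_laterDescendants v i).trans
        (laterDescendants_subset v i))) le_rfl
  have hg : Measurable[blockAlg (descendants T v)]
      fun p : Env T => firstOf (fun i j => arrival n (i :: v) j p) 0 (p.1 (v, k)) := by
    -- The list of children is random, but it has countably many values, so measurability can be
    -- checked for each fixed list.
    have := measurable_from_prod_countable_right (mβ := blockAlg (descendants T v))
      (f := fun q : List T × Env T => firstOf (fun i j => arrival n (i :: v) j q.2) 0 q.1) hf
    exact this.comp ((measurable_children (List.suffix_refl v)).prodMk measurable_id)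
  simp_rw [occupiedUpTo_succ_iff]
  exact measurableSet_le (measurable_label (List.suffix_refl v)) hg

theorem measurable_arrival (n : ℕ) (v : List ℕ) (k : T) :
    Measurable[blockAlg (descendants T v)] (arrival (T := T) n v k) := by
  induction n generalizing v k with
  | zero =>
    have : arrival (T := T) 0 v k = fun _ => 1 := by
      funext p
      simp [arrival, OccupiedUpTo]
    rw [this]
    exact measurable_const
  | succ n ih =>
    exact Measurable.ite (measurableSet_occupiedUpTo_succ ih v k)
      (measurable_label (List.suffix_refl v)) measurable_const

theorem measurableSet_occupiedUpTo (n : ℕ) (v : List ℕ) (k : T) :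
    MeasurableSet {p : Env T | OccupiedUpTo p.1 p.2 n v k} := by
  cases n with
  | zero => exact MeasurableSet.empty
  | succ n => exact blockAlg_le _ _ (measurableSet_occupiedUpTo_succ (measurable_arrival n) v k)

end Measurability

end SimpleBranchingProcess

namespace SimpleBranchingProcess

variable {T : Type*} [Countable T] (B : SimpleBranchingProcess T)

/-- The joint law of the offspring lists and the labels. -/
noncomputable def envLaw : Measure (Env T) :=
  (Measure.infinitePi fun vk : List ℕ × T => (B.childrenLaw vk.2).toMeasure).prod
    (Measure.infinitePi fun _ : List ℕ => (volume : Measure unitInterval))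

instance : IsProbabilityMeasure B.envLaw := by
  unfold envLaw
  infer_instance

theorem envLaw_children (vk : List ℕ × T) (S : Set (List T)) :
    B.envLaw {p | p.1 vk ∈ S} = (B.childrenLaw vk.2).toMeasure S := by
  have h := (measurePreserving_eval_infinitePi
    (fun vk : List ℕ × T => (B.childrenLaw vk.2).toMeasure) vk).comp
    (measurePreserving_fst (μ := Measure.infinitePi
      fun vk : List ℕ × T => (B.childrenLaw vk.2).toMeasure)
      (ν := Measure.infinitePi fun _ : List ℕ => (volume : Measure unitInterval)))
  exact h.measure_preimage (MeasurableSet.of_discrete (s := S)).nullMeasurableSet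

theorem measurePreserving_label (v : List ℕ) :
    MeasurePreserving (fun p : Env T => p.2 v) B.envLaw volume :=
  (measurePreserving_eval_infinitePi (fun _ : List ℕ => (volume : Measure unitInterval)) v).comp
    measurePreserving_snd

/-- Finite intersections of coordinate events are boxes, whose measure factorises under both product
measures. -/
theorem iIndep_coordAlg : iIndep (coordAlg T) B.envLaw := by
  rw [iIndep_iff]
  intro s f hf
  classical
  have h1 : ∀ vk : List ℕ × T, ∃ S : Set (List T),
      Sum.inl vk ∈ s → f (Sum.inl vk) = {p | p.1 vk ∈ S} := by
    intro vk
    by_cases h : Sum.inl vk ∈ s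
    · obtain ⟨S, -, hS⟩ := hf _ h
      exact ⟨S, fun _ => hS.symm⟩
    · exact ⟨∅, fun h' => absurd h' h⟩
  have h2 : ∀ v : List ℕ, ∃ R : Set unitInterval, MeasurableSet R ∧
      (Sum.inr v ∈ s → f (Sum.inr v) = {p | p.2 v ∈ R}) := by
    intro v
    by_cases h : Sum.inr v ∈ s
    · obtain ⟨R, hR, hR'⟩ := hf _ h
      exact ⟨R, hR, fun _ => hR'.symm⟩
    · exact ⟨∅, MeasurableSet.empty, fun h' => absurd h' h⟩
  choose S hS using h1
  choose R hR hR' using h2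
  have hset : (⋂ i ∈ s, f i) = ((s.toLeft : Set (List ℕ × T)).pi S) ×ˢ
      ((s.toRight : Set (List ℕ)).pi R) := by
    ext p
    simp only [mem_iInter, mem_prod, Set.mem_pi, Finset.mem_coe, Finset.mem_toLeft,
      Finset.mem_toRight]
    constructor
    · intro h
      refine ⟨fun vk hvk => ?_, fun v hv => ?_⟩
      · have := h _ hvk
        rwa [hS vk hvk] at this
      · have := h _ hv
        rwa [hR' v hv] at this
    · rintro ⟨ha, hb⟩ (vk | v) hi
      · rw [hS vk hi]; exact ha vk hi
      · rw [hR' v hi]; exact hb v hi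
  rw [hset, envLaw, Measure.prod_prod, Measure.infinitePi_pi _ fun _ _ => MeasurableSet.of_discrete,
    Measure.infinitePi_pi _ fun v _ => hR v]
  conv_rhs => rw [← Finset.toLeft_disjSum_toRight (u := s), Finset.prod_disjSum]
  congr 1
  · refine Finset.prod_congr rfl fun vk hvk => ?_
    rw [hS vk (Finset.mem_toLeft.1 hvk)]
    exact (B.envLaw_children vk (S vk)).symm
  · refine Finset.prod_congr rfl fun v hv => ?_
    rw [hR' v (Finset.mem_toRight.1 hv)]
    exact ((B.measurePreserving_label v).measure_preimage (hR v).nullMeasurableSet).symm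

theorem indep_blockAlg {S S' : Set ((List ℕ × T) ⊕ List ℕ)} (h : Disjoint S S') :
    Indep (blockAlg S) (blockAlg S') B.envLaw :=
  indep_iSup_of_disjoint coordAlg_le B.iIndep_coordAlg h

/-! ### The law of the arrival times -/

theorem measurable_firstOf_arrival (n : ℕ) (v : List ℕ) (m : ℕ) (l : List T) :
    Measurable[blockAlg (laterDescendants T v m)]
      fun p : Env T => firstOf (fun i j => arrival n (i :: v) j p) m l :=
  measurable_firstOf l m fun i hi j => (measurable_arrival n (i :: v) j).mono
    (blockAlg_mono fun _ h => ⟨i, hi, h⟩) le_rfl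

variable {B}

/-- The arrival time of child `m` and those of the later children depend on disjoint blocks of
coordinates; peeling off one child at a time yields the product. -/
theorem envLaw_le_firstOf {n : ℕ} {x : unitInterval}
    (hn : ∀ v j, B.envLaw {p | arrival n v j p < x} = ENNReal.ofReal (B.vacancyIter n j x))
    (v : List ℕ) (m : ℕ) (l : List T) :
    B.envLaw {p | x ≤ firstOf (fun i j => arrival n (i :: v) j p) m l} =
      ENNReal.ofReal (l.map fun j => 1 - B.vacancyIter n j x).prod := by
  induction l generalizing m with
  | nil => simp [firstOf, unitInterval.le_one']
  | cons j l ih =>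
    have hset : {p : Env T | x ≤ firstOf (fun i j => arrival n (i :: v) j p) m (j :: l)} =
        {p | x ≤ arrival n (m :: v) j p} ∩
          {p | x ≤ firstOf (fun i j => arrival n (i :: v) j p) (m + 1) l} := by
      ext p
      simp [firstOf]
    have hm1 := measurable_arrival n (m :: v) j
    have hind := (Indep_iff _ _ _).1
      (B.indep_blockAlg (disjoint_descendants_laterDescendants (T := T) v m))
      {p | x ≤ arrival n (m :: v) j p}
      {p | x ≤ firstOf (fun i j => arrival n (i :: v) j p) (m + 1) l}
      (hm1 measurableSet_Ici) (measurable_firstOf_arrival n v (m + 1) l measurableSet_Ici)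
    have hcompl : {p : Env T | x ≤ arrival n (m :: v) j p} = {p | arrival n (m :: v) j p < x}ᶜ := by
      ext p
      simp
    have hmem := vacancyIter_mem_unit (B := B) n j x.2
    rw [hset, hind, ih, hcompl, prob_compl_eq_one_sub, hn, List.map_cons, List.prod_cons,
      ENNReal.ofReal_mul (by linarith [hmem.2]), ENNReal.ofReal_sub _ hmem.1, ENNReal.ofReal_one]
    exact blockAlg_le _ _ (hm1 measurableSet_Iio)

theorem continuous_vacancyIter_unitInterval (n : ℕ) (k : T) :
    Continuous fun s : unitInterval => B.vacancyIter n k s :=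
  continuousOn_iff_continuous_domRestrict.1 (vacancyIter_continuousOn_and_mem n k).1

theorem setLIntegral_unitInterval {f : ℝ → ℝ} (hf : ContinuousOn f (Icc 0 1))
    (hf0 : ∀ s ∈ Icc (0 : ℝ) 1, 0 ≤ f s) (x : unitInterval) :
    ∫⁻ s in Iio x, ENNReal.ofReal (f s) = ENNReal.ofReal (∫ s in (0 : ℝ)..x, f s) := by
  have hsub : Ioc (0 : ℝ) x ⊆ Icc 0 1 := fun s hs => ⟨hs.1.le, hs.2.trans x.2.2⟩
  have h := (measurePreserving_subtype_coe (μa := volume) (s := Icc (0 : ℝ) 1)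
    measurableSet_Icc).setLIntegral_comp_preimage_emb
    (MeasurableEmbedding.subtype_coe measurableSet_Icc) (fun s => ENNReal.ofReal (f s))
    (Iio (x : ℝ))
  rw [Measure.restrict_restrict measurableSet_Iio] at h
  have hI : Iio (x : ℝ) ∩ Icc 0 1 = Ico 0 (x : ℝ) := by
    ext s
    simp only [mem_inter_iff, mem_Iio, mem_Icc, mem_Ico]
    exact ⟨fun h => ⟨h.2.1, h.1⟩, fun h => ⟨h.2, h.1, h.2.le.trans x.2.2⟩⟩
  rw [hI, restrict_Ico_eq_restrict_Ioc] at h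
  rw [intervalIntegral.integral_of_le x.2.1, ofReal_integral_eq_lintegral_ofReal]
  · exact h
  · exact (hf.integrableOn_Icc).mono_set hsub
  · filter_upwards [ae_restrict_mem measurableSet_Ioc] with s hs
    exact hf0 s (hsub hs)

/-- The label of `v` is uniform and independent of all its proper descendants, so one conditions on
its value `s`. This is where the integral of the Picard iteration comes from. -/
theorem envLaw_label_lt_le_firstOf {n : ℕ}
    (hn : ∀ v j (x : unitInterval),
      B.envLaw {p | arrival n v j p < x} = ENNReal.ofReal (B.vacancyIter n j x))
    (v : List ℕ) (l : List T) (x : unitInterval) :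
    B.envLaw {p | p.2 v < x ∧ p.2 v ≤ firstOf (fun i j => arrival n (i :: v) j p) 0 l} =
      ∫⁻ s in Iio x, ENNReal.ofReal (l.map fun j => 1 - B.vacancyIter n j s).prod := by
  set M : Env T → unitInterval := fun p => firstOf (fun i j => arrival n (i :: v) j p) 0 l with hM
  have hMm : Measurable[blockAlg (laterDescendants T v 0)] M := measurable_firstOf_arrival n v 0 l
  have hMm' : Measurable M := hMm.mono (blockAlg_le _) le_rfl
  have hv : Measurable fun p : Env T => p.2 v := (B.measurePreserving_label v).measurable
  have hind : IndepFun (fun p : Env T => p.2 v) M B.envLaw := by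
    have h := B.indep_blockAlg (S := {Sum.inr v}) (S' := laterDescendants T v 0)
      (Set.disjoint_singleton_left.2 (notMem_laterDescendants_of_elim_eq rfl))
    rw [IndepFun_iff_Indep]
    exact indep_of_indep_of_le_left (indep_of_indep_of_le_right h (measurable_iff_comap_le.1 hMm))
      (measurable_iff_comap_le.1 (measurable_label rfl))
  have hmap := (indepFun_iff_map_prod_eq_prod_map_map hv.aemeasurable hMm'.aemeasurable).1 hind
  rw [(B.measurePreserving_label v).map_eq] at hmap
  have hS : MeasurableSet {q : unitInterval × unitInterval | q.1 < x ∧ q.1 ≤ q.2} :=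
    (measurable_fst measurableSet_Iio).inter measurableSet_le'
  have e : {p : Env T | p.2 v < x ∧ p.2 v ≤ M p} =
      (fun p => (p.2 v, M p)) ⁻¹' {q : unitInterval × unitInterval | q.1 < x ∧ q.1 ≤ q.2} := rfl
  rw [e, ← Measure.map_apply (hv.prodMk hMm') hS, hmap, Measure.prod_apply hS,
    ← lintegral_indicator measurableSet_Iio]
  refine lintegral_congr fun s => ?_
  by_cases hs : s < x
  · rw [indicator_of_mem (by exact hs), ← envLaw_le_firstOf (fun v j => hn v j s) v 0 l]
    have : (Prod.mk s ⁻¹' {q : unitInterval × unitInterval | q.1 < x ∧ q.1 ≤ q.2}) = Ici s := by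
      ext t
      simp [hs]
    rw [this, Measure.map_apply hMm' measurableSet_Ici]
    rfl
  · rw [indicator_of_notMem (by exact hs)]
    have : (Prod.mk s ⁻¹' {q : unitInterval × unitInterval | q.1 < x ∧ q.1 ≤ q.2}) = ∅ := by
      ext t
      simp [hs]
    rw [this, measure_empty]

theorem envLaw_arrival_lt (n : ℕ) (v : List ℕ) (k : T) (x : unitInterval) :
    B.envLaw {p | arrival n v k p < x} = ENNReal.ofReal (B.vacancyIter n k x) := by
  induction n generalizing v k x with
  | zero => simp [arrival_lt_iff, OccupiedUpTo, vacancyIter]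
  | succ n ih =>
    let E : List T → Set (Env T) := fun l =>
      {p | p.2 v < x ∧ p.2 v ≤ firstOf (fun i j => arrival n (i :: v) j p) 0 l}
    have hset : {p : Env T | arrival (n + 1) v k p < x} =
        ⋃ l : List T, {p | p.1 (v, k) ∈ ({l} : Set (List T))} ∩ E l := by
      ext p
      simp only [mem_ofPred_eq, arrival_lt_iff, occupiedUpTo_succ_iff, mem_iUnion, mem_inter_iff,
        mem_singleton_iff, E]
      constructor
      · intro h
        exact ⟨_, rfl, h.2, h.1⟩
      · rintro ⟨l, rfl, h⟩
        exact ⟨h.2, h.1⟩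
    -- For a fixed list `l`, `E l` involves only the label of `v` and the coordinates below `v`,
    -- hence is independent of the offspring list at `(v, k)`.
    let S : Set ((List ℕ × T) ⊕ List ℕ) := insert (Sum.inr v) (laterDescendants T v 0)
    have hE : ∀ l, MeasurableSet[blockAlg S] (E l) := by
      intro l
      have h1 : Measurable[blockAlg S] fun p : Env T => p.2 v :=
        measurable_label (mem_insert _ _)
      have h2 := (measurable_firstOf_arrival n v 0 l).mono
        (blockAlg_mono (subset_insert (Sum.inr v) _)) le_rfl
      let m := blockAlg S
      have h3 := measurableSet_le h1 h2
      exact (h1 measurableSet_Iio).inter h3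
    have hC : ∀ l, MeasurableSet[blockAlg {Sum.inl (v, k)}]
        {p : Env T | p.1 (v, k) ∈ ({l} : Set (List T))} := fun l =>
      measurable_children (mem_singleton _) MeasurableSet.of_discrete
    have hdisj : Disjoint {Sum.inl (v, k)} S := by
      rw [Set.disjoint_singleton_left]
      rintro (h | h)
      · exact absurd h (by simp)
      · exact notMem_laterDescendants_of_elim_eq (i := Sum.inl (v, k)) rfl h
    have hind := (Indep_iff _ _ _).1 (B.indep_blockAlg hdisj)
    have hpd : Pairwise (Function.onFun Disjoint
        fun l : List T => {p : Env T | p.1 (v, k) ∈ ({l} : Set (List T))} ∩ E l) := by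
      intro l l' hl
      rw [Function.onFun, Set.disjoint_left]
      rintro p ⟨h, -⟩ ⟨h', -⟩
      exact hl (h.symm.trans h')
    have hu : ∀ s : unitInterval, ∀ j, B.vacancyIter n j s ∈ Icc (0 : ℝ) 1 := fun s j =>
      vacancyIter_mem_unit n j s.2
    rw [hset, measure_iUnion hpd fun l => (blockAlg_le _ _ (hC l)).inter (blockAlg_le _ _ (hE l))]
    simp_rw [fun l => hind _ _ (hC l) (hE l), envLaw_children,
      PMF.toMeasure_apply_singleton _ _ (MeasurableSet.of_discrete (s := ({_} : Set (List T)))),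
      E, envLaw_label_lt_le_firstOf ih]
    have hprod : ∀ l : List T,
        Continuous fun s : unitInterval => (l.map fun j => 1 - B.vacancyIter n j s).prod := by
      intro l
      induction l with
      | nil => simpa using continuous_const
      | cons j l ih =>
        simp only [List.map_cons, List.prod_cons]
        exact (continuous_const.sub (continuous_vacancyIter_unitInterval n j)).mul ih
    simp_rw [← lintegral_const_mul' _ _ (PMF.apply_ne_top (B.childrenLaw k) _)]
    have hmeas : ∀ l : List T, AEMeasurable (fun s : unitInterval => B.childrenLaw k l *
        ENNReal.ofReal (l.map fun j => 1 - B.vacancyIter n j s).prod) (volume.restrict (Iio x)) :=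
      fun l => ((hprod l).measurable.ennreal_ofReal.const_mul _).aemeasurable
    -- Tonelli: averaging over the offspring lists under the integral reproduces the vacancy field.
    rw [← lintegral_tsum hmeas]
    rw [vacancyIter, ← setLIntegral_unitInterval (continuousOn_vacancyField_vacancyIter n k)
      (fun s hs => (vacancyField_mem fun j => vacancyIter_mem_unit n j hs).1)]
    refine lintegral_congr fun s => ?_
    rw [vacancyField, ENNReal.ofReal_tsum_of_nonneg
      (fun l => mul_nonneg ENNReal.toReal_nonneg (list_prod_one_sub_mem (hu s) l).1)
      (summable_vacancyField (hu s))]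
    refine tsum_congr fun l => ?_
    rw [ENNReal.ofReal_mul ENNReal.toReal_nonneg, ENNReal.ofReal_toReal (PMF.apply_ne_top _ _)]

theorem envLaw_occupiedUpTo (n : ℕ) (v : List ℕ) (k : T) :
    B.envLaw {p | OccupiedUpTo p.1 p.2 n v k} = ENNReal.ofReal (B.vacancyIter n k 1) := by
  have h := envLaw_arrival_lt (B := B) n v k 1
  rw [Set.Icc.coe_one] at h
  rw [← h]
  refine measure_congr ?_
  have h1 : ∀ᵐ p ∂B.envLaw, p.2 v ≠ 1 := by
    have : ∀ᵐ s : unitInterval, s ≠ 1 := by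
      rw [ae_iff]
      simp
    exact (B.measurePreserving_label v).quasiMeasurePreserving.ae this
  filter_upwards [h1] with p hp
  refine propext ⟨fun h => (arrival_lt_iff n v k p 1).2 ⟨h, ?_⟩,
    fun h => ((arrival_lt_iff n v k p 1).1 h).1⟩
  exact lt_of_le_of_ne unitInterval.le_one' hp

end SimpleBranchingProcess

/-! ### Passage to infinite depth and conclusion -/

namespace SimpleBranchingProcess

variable {T : Type*}

/-- The event that the root is occupied if the tree is explored up to depth `n`. -/
def rootOccupied (T : Type*) (n : ℕ) : Set (T × Env T) :=
  {q | OccupiedUpTo q.2.1 q.2.2 n [] q.1}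

theorem rootOccupied_eq_iUnion (n : ℕ) :
    rootOccupied T n = ⋃ k : T, {k} ×ˢ {p : Env T | OccupiedUpTo p.1 p.2 n [] k} := by
  ext q
  simp only [mem_iUnion, mem_prod, mem_singleton_iff, rootOccupied, mem_ofPred_eq]
  exact ⟨fun h => ⟨q.1, rfl, h⟩, fun ⟨k, hk, h⟩ => by rw [hk]; exact h⟩

variable [MeasurableSpace T]

/-- The sample space is isomorphic to a product. -/
def Sample.prodEquiv : T × Env T ≃ᵐ Sample T where
  toFun := Sample.ofProd
  invFun ω := (ω.rootType, ω.children, ω.label)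
  left_inv _ := rfl
  right_inv _ := rfl
  measurable_toFun := fun _ hs => hs
  measurable_invFun := fun _ hs => hs

variable [Countable T] (B : SimpleBranchingProcess T)

theorem law_eq_map : B.law = (B.root.toMeasure.prod B.envLaw).map Sample.prodEquiv := rfl

variable [DiscreteMeasurableSpace T]

theorem measurableSet_rootOccupied (n : ℕ) : MeasurableSet (rootOccupied T n) := by
  rw [rootOccupied_eq_iUnion]
  exact MeasurableSet.iUnion fun k =>
    (measurableSet_singleton k).prod (measurableSet_occupiedUpTo n [] k)

theorem hasSum_rootOccupied (n : ℕ) :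
    HasSum (fun k => B.vacancyIter n k 1 * (B.root k).toReal)
      ((B.root.toMeasure.prod B.envLaw).real (rootOccupied T n)) := by
  have h0 : ∀ k, 0 ≤ B.vacancyIter n k 1 := fun k =>
    (vacancyIter_mem_unit n k (by simp)).1
  have h : (B.root.toMeasure.prod B.envLaw) (rootOccupied T n) =
      ∑' k, B.root k * ENNReal.ofReal (B.vacancyIter n k 1) := by
    rw [rootOccupied_eq_iUnion, measure_iUnion]
    · refine tsum_congr fun k => ?_
      rw [Measure.prod_prod, PMF.toMeasure_apply_singleton _ _ (measurableSet_singleton k),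
        envLaw_occupiedUpTo]
    · intro k k' hk
      rw [Function.onFun, Set.disjoint_left]
      rintro q ⟨h, -⟩ ⟨h', -⟩
      exact hk (h.symm.trans h')
    · exact fun k => (measurableSet_singleton k).prod (measurableSet_occupiedUpTo n [] k)
  have hs := ENNReal.hasSum_toReal (f := fun k => B.root k * ENNReal.ofReal (B.vacancyIter n k 1))
    (by rw [← h]; exact measure_ne_top _ _)
  rw [← ENNReal.tsum_toReal_eq
    (fun k => ENNReal.mul_ne_top (PMF.apply_ne_top _ _) ENNReal.ofReal_ne_top), ← h] at hs
  simpa [Measure.real, ENNReal.toReal_mul, ENNReal.toReal_ofReal (h0 _), mul_comm] using hs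

variable {B}

theorem tendsto_rootOccupied (hB : B.NonexplosiveGrowth) :
    Tendsto (fun n => (B.root.toMeasure.prod B.envLaw).real (rootOccupied T n)) atTop
      (𝓝 B.iota) := by
  have hB' : ∀ᵐ q ∂B.root.toMeasure.prod B.envLaw, ∀ᶠ n in atTop, q ∈ rootOccupied T n ↔
      (Sample.ofProd q).tree.GreedyOccupied (Sample.ofProd q).treeLabel (Sample.ofProd q).root := by
    have h : ∀ᵐ ω ∂B.law, (ω.tree.past ω.treeLabel ω.root).Finite := hB
    rw [law_eq_map] at h
    filter_upwards [ae_of_ae_map Sample.prodEquiv.measurable.aemeasurable h] with q hq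
    exact Sample.eventually_greedyOccupied_iff hq
  -- This measurable set agrees almost surely with the occupation event, whose own measurability is
  -- then not needed.
  let A : Set (T × Env T) := liminf (rootOccupied T) atTop
  have hA : MeasurableSet A := MeasurableSet.measurableSet_liminf measurableSet_rootOccupied
  have hmem : ∀ q, q ∈ A ↔ ∀ᶠ n in atTop, q ∈ rootOccupied T n := fun q => mem_liminf_iff_eventually_mem
  have hAe : ∀ᵐ q ∂B.root.toMeasure.prod B.envLaw, q ∈ A ↔
      (Sample.ofProd q).tree.GreedyOccupied (Sample.ofProd q).treeLabel (Sample.ofProd q).root := by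
    filter_upwards [hB'] with q hq
    rw [hmem, eventually_congr hq, eventually_const]
  have hiota : B.iota = (B.root.toMeasure.prod B.envLaw).real A := by
    rw [iota, Measure.real, law_eq_map, MeasurableEquiv.map_apply, Measure.real]
    congr 1
    refine measure_congr ?_
    filter_upwards [hAe] with q hq
    exact propext hq.symm
  rw [hiota]
  refine (ENNReal.tendsto_toReal (measure_ne_top _ _)).comp
    (tendsto_measure_of_ae_tendsto_indicator_of_isFiniteMeasure atTop hA
      measurableSet_rootOccupied ?_)
  filter_upwards [hAe, hB'] with q h1 h2
  filter_upwards [h2] with n hn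
  rw [hn, h1]

/-- The averaged solution lies between the even and the odd depth probabilities, and both
subsequences tend to `iota`. -/
theorem hasSum_solution_iota (hB : B.NonexplosiveGrowth) {y : T → ℝ → ℝ}
    (hmem : ∀ k, ∀ x ∈ Icc (0 : ℝ) 1, 0 ≤ y k x ∧ y k x ≤ x)
    (hy : ∀ k, y k 0 = 0 ∧ ∀ x ∈ Icc (0 : ℝ) 1,
      HasDerivWithinAt (y k) (B.vacancyField k fun j => y j x) (Icc 0 1) x) :
    HasSum (fun k => y k 1 * (B.root k).toReal) B.iota := by
  have h1 : (1 : ℝ) ∈ Icc (0 : ℝ) 1 := by simp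
  have hsum : Summable fun k => y k 1 * (B.root k).toReal := by
    have hr : Summable fun k => (B.root k).toReal :=
      ENNReal.summable_toReal (by rw [PMF.tsum_coe]; exact ENNReal.one_ne_top)
    exact Summable.of_nonneg_of_le (fun k => mul_nonneg (hmem k 1 h1).1 ENNReal.toReal_nonneg)
      (fun k => mul_le_of_le_one_left ENNReal.toReal_nonneg (hmem k 1 h1).2) hr
  have hlim := tendsto_rootOccupied hB
  have hlow : ∀ n, (B.root.toMeasure.prod B.envLaw).real (rootOccupied T (2 * n)) ≤
      ∑' k, y k 1 * (B.root k).toReal := fun n =>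
    hasSum_le (fun k => mul_le_mul_of_nonneg_right (vacancyIter_le_and_le hmem hy n k h1).1
      ENNReal.toReal_nonneg) (B.hasSum_rootOccupied (2 * n)) hsum.hasSum
  have hupp : ∀ n, ∑' k, y k 1 * (B.root k).toReal ≤
      (B.root.toMeasure.prod B.envLaw).real (rootOccupied T (2 * n + 1)) := fun n =>
    hasSum_le (fun k => mul_le_mul_of_nonneg_right (vacancyIter_le_and_le hmem hy n k h1).2
      ENNReal.toReal_nonneg) hsum.hasSum (B.hasSum_rootOccupied (2 * n + 1))
  have hdouble : Tendsto (fun n : ℕ => 2 * n) atTop atTop :=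
    tendsto_atTop_mono (fun n => by simp only [id]; omega) tendsto_id
  have hdouble' : Tendsto (fun n : ℕ => 2 * n + 1) atTop atTop :=
    tendsto_atTop_mono (fun n => by simp only [id]; omega) tendsto_id
  have : ∑' k, y k 1 * (B.root k).toReal = B.iota :=
    le_antisymm (ge_of_tendsto' (hlim.comp hdouble') hupp) (le_of_tendsto' (hlim.comp hdouble) hlow)
  rw [← this]
  exact hsum.hasSum

end SimpleBranchingProcess

theorem theorem1p3 {T : Type*} [Countable T] [MeasurableSpace T] [DiscreteMeasurableSpace T]
    (B : SimpleBranchingProcess T) (hB : B.NonexplosiveGrowth) :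
    (∃ y : T → ℝ → ℝ, B.IsFundamentalSolution y ∧
      (∀ k, ∀ x ∈ Set.Icc (0 : ℝ) 1, 0 ≤ y k x ∧ y k x ≤ x) ∧
      HasSum (fun k => y k 1 * (B.root k).toReal) B.iota) ∧
    (∀ y : T → ℝ → ℝ, B.IsFundamentalSolution y →
      (∀ k, ∀ x ∈ Set.Icc (0 : ℝ) 1, 0 ≤ y k x ∧ y k x ≤ x) →
      HasSum (fun k => y k 1 * (B.root k).toReal) B.iota) := by
  refine ⟨?_, fun y hy hmem => SimpleBranchingProcess.hasSum_solution_iota hB hmem fun k => ⟨(hy k).1, fun x hx => ?_⟩⟩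
  -- The solution is built for the autonomous field; its bounds `0 ≤ y k x ≤ x` are what allows the
  -- return to the time-dependent one.
  · obtain ⟨y, hy⟩ := exists_solution_of_continuousOn (F := B.vacancyField)
      (fun k z hz => SimpleBranchingProcess.vacancyField_mem hz) fun k => SimpleBranchingProcess.continuousOn_vacancyField
    have hmem : ∀ k, ∀ x ∈ Set.Icc (0 : ℝ) 1, 0 ≤ y k x ∧ y k x ≤ x := fun k x hx =>
      ((hy k).2 x hx).1
    refine ⟨y, fun k => ⟨(hy k).1, fun x hx => ?_⟩, hmem,
      SimpleBranchingProcess.hasSum_solution_iota hB hmem fun k => ⟨(hy k).1, fun x hx => ((hy k).2 x hx).2⟩⟩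
    rw [SimpleBranchingProcess.fundamentalField_eq_vacancyField B k hx fun j => hmem j x hx]
    exact ((hy k).2 x hx).2
  · rw [← SimpleBranchingProcess.fundamentalField_eq_vacancyField B k hx fun j => hmem j x hx]
    exact (hy k).2 x hx
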